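/- Let $X$ be a path connected topological space. For $f:X\to\mathbb R$ put $X_t=f^{-1}((-\infty,t])$ and let $\pi_0(X_t)$ be its set of path components. The function $f$ is called tame if every $\pi_0(X_t)$ is finite and there are finitely many critical values $t_1<\dots<t_n$ such that $X_t=\emptyset$ for $t<t_1$ and $\pi_0(X_t)\to\pi_0(X_{t'})$ is bijective whenever $t\le t'$ both lie in the same interval $(t_i,t_{i+1})$ or both lie in $(t_n,\infty)$. For a tame function $f$ that is bounded above, the merge tree $T_f$ is the following finite rooted tree with a height function. Let $\pi_0^+(t)=\varprojlim_{s\downarrow t}\pi_0(X_s)$ be the set of components just above the level $t$ (if $\pi_0(X_t)\to\pi_0(X_s)$ is bijective for all $s>t$ close to $t$, this is $\pi_0(X_t)$). Besides the root, which has height $+\infty$, $T_f$ has one vertex of height $t$ for each $U\in\pi_0^+(t)$ that either is not in the image of $\pi_0^+(s)$ for any $s<t$ (a leaf), or is a component in which two components from some lower level $s<t$, distinct at all levels in $[s,t)$, merge. The father of a vertex is the lowest vertex strictly above it with respect to the inclusion of components, or the root if there is none. For a real number $K$ larger than all finite heights of $T_f$, truncate $T_f$ at $K$ (the root gets height $K$)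 and give the edge from a vertex $v$ to its father the positive weight (height of the father) $-$ (height of $v$). Finite rooted trees with positive edge weights, up to isomorphism, are modified by the following edits: shrinking, i.e. replacing the weight of one edge by another positive number, at a cost equal to the absolute value of the difference of the two weights; deleting the edge between a vertex $v$ that is not the root and its father, where $v$ is removed and its children are attached to its father with unchanged weights, or the inverse insertion, at a cost equal to the weight of the deleted or inserted edge; ghosting a vertex $v$ that is not the root and has exactly one child, where $v$ is removed and its two edges are replaced by one edge whose weight is the sum of their weights, or the inverse splitting, at cost $0$. An edit path is a finite sequence of edits, its cost is the sum of the costs of its edits, and $d_E(T,T')$ is the infimum of the costs of the edit paths from $T$ to $T'$. **Theorem.** Let $f,g:X\to\mathbb R$ be tame and bounded above, with $\sup_{x\in X}|f(x)-g(x)|\le\varepsilon$. Let $N$ and $M$ be the numbers of vertices, including the roots, of $T_f$ and $T_g$, and truncate both trees at a common height $K$ larger than all their finite heights. Then there is an edit path from $T_f$ to $T_g$ made of at most $N+M$ edits, each of cost at most $2\varepsilon$. In particular $d_E(T_f,T_g)\le 2\varepsilon(N+M)$. -/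

import Mathlib

universe u

namespace MergeTrees

/-! ### Trees -/

/-- A finite rooted tree, given by its father map. By convention the root is its own father; every
other vertex `v` is joined by an edge to `parent v`, and following fathers leads to the root. The
edges are the pairs `(v, parent v)` with `v ≠ root`. -/
structure RootedTree where
  V : Type u
  [fintype : Fintype V]
  root : V
  parent : V → V
  parent_root : parent root = root
  reaches_root : ∀ v, ∃ n : ℕ, parent^[n] v = root

attribute [instance] RootedTree.fintype

/-- A merge tree: a finite rooted tree whose root has order `1`, with an increasing height function
with values in `ℝ ∪ {+∞}` which is `+∞` exactly at the root. -/
structure MergeTree extends RootedTree.{u} where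
  height : V → WithTop ℝ
  height_root : height root = ⊤
  height_ne_top : ∀ v, v ≠ root → height v ≠ ⊤
  height_lt_parent : ∀ v, v ≠ root → height v < height (parent v)
  root_order_one : ∃! v, v ≠ root ∧ parent v = root

/-- A finite rooted tree with a positive weight on every edge `(v, parent v)`, `v ≠ root`. The value
of `weight` at the root has no meaning and is never used. -/
structure WeightedTree extends RootedTree.{u} where
  weight : V → ℝ
  weight_pos : ∀ v, v ≠ root → 0 < weight v

namespace MergeTree

/-- The height function truncated at `K`: the root gets height `K` instead of `+∞`. -/
noncomputable def truncHeight (T : MergeTree.{u}) (K : ℝ) (v : T.V) : ℝ :=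
  (T.height v).untopD K

/-- The weighted tree of a merge tree truncated at a height `K` above all its finite heights: the
edge `(v, parent v)` is weighted by the difference of the truncated heights. -/
noncomputable def truncate (T : MergeTree.{u}) (K : ℝ)
    (hK : ∀ v, v ≠ T.root → T.height v < (K : WithTop ℝ)) : WeightedTree.{u} where
  toRootedTree := T.toRootedTree
  weight v := T.truncHeight K (T.parent v) - T.truncHeight K v
  weight_pos v hv := by
    have h1 := T.height_ne_top v hv
    have h2 := T.height_lt_parent v hv
    have h3 := hK v hv
    unfold truncHeight
    obtain ⟨a, ha⟩ := WithTop.ne_top_iff_exists.mp h1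
    rw [← ha] at h2 h3 ⊢
    cases hp : T.height (T.parent v) with
    | top => simpa using h3
    | coe b => rw [hp] at h2; simpa using h2

end MergeTree

/-! ### Edits of weighted trees and the edit distance -/

namespace WeightedTree

/-- Isomorphism of weighted trees. -/
def IsIso (T T' : WeightedTree.{u}) : Prop :=
  ∃ e : T.V ≃ T'.V, e T.root = T'.root ∧ (∀ u, e (T.parent u) = T'.parent (e u)) ∧
    ∀ u, u ≠ T.root → T'.weight (e u) = T.weight u

/-- `T'` arises from `T` by changing the weight of the edge `(v, parent v)` to the positive
value `w`. -/
def IsShrinking (T T' : WeightedTree.{u}) (v : T.V) (w : ℝ) : Prop :=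
  v ≠ T.root ∧ ∃ e : T.V ≃ T'.V, e T.root = T'.root ∧
    (∀ u, e (T.parent u) = T'.parent (e u)) ∧
    (∀ u, u ≠ T.root → u ≠ v → T'.weight (e u) = T.weight u) ∧ T'.weight (e v) = w

open Classical in
/-- As a tree without weights, `T'` is `T` with the vertex `v` (not the root) removed and the
children of `v` attached to the father of `v`; the map `ι` sends the vertices of `T'` to the
corresponding vertices of `T`. -/
def RemovesVertex (T T' : WeightedTree.{u}) (v : T.V) (ι : T'.V → T.V) : Prop :=
  v ≠ T.root ∧ Function.Injective ι ∧ Set.range ι = {v}ᶜ ∧ ι T'.root = T.root ∧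
    ∀ u, ι (T'.parent u) = if T.parent (ι u) = v then T.parent v else T.parent (ι u)

/-- `T'` arises from `T` by deleting the edge `(v, parent v)` together with its lower vertex `v`;
all other weights are unchanged. -/
def IsDeletion (T T' : WeightedTree.{u}) (v : T.V) : Prop :=
  ∃ ι : T'.V → T.V, RemovesVertex T T' v ι ∧ ∀ u, u ≠ T'.root → T'.weight u = T.weight (ι u)

open Classical in
/-- `T'` arises from `T` by ghosting the order two vertex `v`: `v` is not the root, it has exactly
one child `c`, and the edges `(c, v)` and `(v, parent v)` are replaced by one edge whose weight is
the sum of the two weights. -/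
def IsGhosting (T T' : WeightedTree.{u}) (v : T.V) : Prop :=
  ∃ (c : T.V) (ι : T'.V → T.V), (∀ u, (u ≠ T.root ∧ T.parent u = v) ↔ u = c) ∧
    RemovesVertex T T' v ι ∧
    ∀ u, u ≠ T'.root →
      T'.weight u = if ι u = c then T.weight c + T.weight v else T.weight (ι u)

/-- `Edit T T' c`: some edit turns `T` into `T'`, at cost `c`. Insertions and splittings are the
inverses of deletions and ghostings. -/
inductive Edit : WeightedTree.{u} → WeightedTree.{u} → ℝ → Prop
  | shrink {T T' : WeightedTree.{u}} {v : T.V} {w : ℝ} (h : IsShrinking T T' v w) :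
      Edit T T' |w - T.weight v|
  | delete {T T' : WeightedTree.{u}} {v : T.V} (h : IsDeletion T T' v) : Edit T T' (T.weight v)
  | insert {T T' : WeightedTree.{u}} {v : T'.V} (h : IsDeletion T' T v) : Edit T T' (T'.weight v)
  | ghost {T T' : WeightedTree.{u}} {v : T.V} (h : IsGhosting T T' v) : Edit T T' 0
  | split {T T' : WeightedTree.{u}} {v : T'.V} (h : IsGhosting T' T v) : Edit T T' 0

/-- `EditPath T T' cs`: there is a finite sequence of edits, with `cs` the list of their costs,
which turns `T` into (a tree isomorphic to) `T'`. -/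
inductive EditPath : WeightedTree.{u} → WeightedTree.{u} → List ℝ → Prop
  | nil {T T' : WeightedTree.{u}} (h : IsIso T T') : EditPath T T' []
  | cons {T T₁ T' : WeightedTree.{u}} {c : ℝ} {cs : List ℝ} (h : Edit T T₁ c)
      (hs : EditPath T₁ T' cs) : EditPath T T' (c :: cs)

/-- The edit distance: the infimum of the costs of the edit paths from `T` to `T'`, where the cost
of an edit path is the sum of the costs of its edits. -/
noncomputable def editDist (T T' : WeightedTree.{u}) : ℝ :=
  sInf {c : ℝ | ∃ cs : List ℝ, EditPath T T' cs ∧ cs.sum = c}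

end WeightedTree

/-! ### The sublevel set filtration and tame functions -/

section Filtration

variable {X : Type u} [TopologicalSpace X]

/-- The set `π₀(X_t)` of path components of the sublevel set `X_t = {x | f x ≤ t}`. -/
abbrev Comp (f : X → ℝ) (t : ℝ) : Type u := ZerothHomotopy {x : X // f x ≤ t}

/-- The inclusion `X_t → X_t'` of sublevel sets, for `t ≤ t'`. -/
def sublevelInclusion (f : X → ℝ) {t t' : ℝ} (h : t ≤ t') (x : {x : X // f x ≤ t}) :
    {x : X // f x ≤ t'} :=
  ⟨x.1, x.2.trans h⟩

theorem continuous_sublevelInclusion (f : X → ℝ) {t t' : ℝ} (h : t ≤ t') :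
    Continuous (sublevelInclusion f h) :=
  continuous_subtype_val.subtype_mk _

/-- The map `π₀(X_t) → π₀(X_t')` induced by the inclusion, for `t ≤ t'`. -/
def Comp.map (f : X → ℝ) {t t' : ℝ} (h : t ≤ t') : Comp f t → Comp f t' :=
  ZerothHomotopy.lift (fun x => ZerothHomotopy.mk (sublevelInclusion f h x))
    (fun _ _ p => ZerothHomotopy.sound (p.map (continuous_sublevelInclusion f h)))

theorem Comp.map_self (f : X → ℝ) {t : ℝ} (h : t ≤ t) (u : Comp f t) : Comp.map f h u = u := by
  induction u using ZerothHomotopy.rec with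
  | mk x => rfl

theorem Comp.map_map (f : X → ℝ) {r s t : ℝ} (h : r ≤ s) (h' : s ≤ t) (u : Comp f r) :
    Comp.map f h' (Comp.map f h u) = Comp.map f (h.trans h') u := by
  induction u using ZerothHomotopy.rec with
  | mk x => rfl

/-- `S` is a set of critical values of `f`: the sublevel sets below all elements of `S` are empty,
and `π₀(X_t) → π₀(X_t')` is bijective if `t` and `t'` lie in the same connected component of the
complement of `S`. -/
structure IsCriticalSet (f : X → ℝ) (S : Finset ℝ) : Prop where
  empty_below : ∀ t, (∀ s ∈ S, t < s) → ∀ x, ¬ f x ≤ t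
  bijective : ∀ t t' (h : t ≤ t'), (∀ s ∈ S, ¬ (t ≤ s ∧ s ≤ t')) →
    Function.Bijective (Comp.map f h)

/-- A function is tame if it has a finite set of critical values and every sublevel set has finitely
many path components. -/
structure IsTame (f : X → ℝ) : Prop where
  exists_criticalSet : ∃ S : Finset ℝ, IsCriticalSet f S
  finite_comp : ∀ t, Finite (Comp f t)

/-! ### The merge tree of a tame function -/

/-- The path components just above the level `t`: compatible families of components of `X_s`,
`s > t`, that is, the inverse limit of `π₀(X_s)` for `s ↓ t`. For a tame `f` it is in bijection with
`π₀(X_s)` for all `s > t` close to `t`, and if all topological changes happen at the critical values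
it is in bijection with `π₀(X_t)`, see `Branch.ofComp_bijective`. -/
def Branch (f : X → ℝ) (t : ℝ) : Type u :=
  {b : ∀ s : Set.Ioi t, Comp f s.1 //
    ∀ (r s : Set.Ioi t) (h : r.1 ≤ s.1), Comp.map f h (b r) = b s}

namespace Branch

variable {f : X → ℝ}

/-- The map `Branch f t → Branch f t'` for `t ≤ t'`. -/
def map {t t' : ℝ} (h : t ≤ t') (b : Branch f t) : Branch f t' :=
  ⟨fun s => b.1 ⟨s.1, lt_of_le_of_lt h s.2⟩, fun r s hrs =>
    b.2 ⟨r.1, lt_of_le_of_lt h r.2⟩ ⟨s.1, lt_of_le_of_lt h s.2⟩ hrs⟩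

/-- The map from the path components of `X_t` to the path components just above `t`. -/
def ofComp {t : ℝ} (u : Comp f t) : Branch f t :=
  ⟨fun s => Comp.map f (le_of_lt s.2) u, fun _ _ _ => Comp.map_map f _ _ u⟩

theorem ext_of_forall {t : ℝ} {b b' : Branch f t} (h : ∀ s, b.1 s = b'.1 s) : b = b' :=
  Subtype.ext (funext h)

/-- If the topological changes happen at `t`, then the components just above `t` are the path
components of `X_t`. -/
theorem ofComp_bijective {t : ℝ}
    (h : ∃ C > 0, ∀ δ (h0 : 0 < δ), δ < C →
      Function.Bijective (Comp.map f (t := t) (t' := t + δ) (by linarith))) :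
    Function.Bijective (ofComp : Comp f t → Branch f t) := by
  obtain ⟨C, hC, h⟩ := h
  constructor
  · intro u v huv
    refine (h (C / 2) (by linarith) (by linarith)).1 ?_
    exact congrArg (fun b : Branch f t => b.1 ⟨t + C / 2, by simp; linarith⟩) huv
  · intro b
    obtain ⟨u, hu⟩ := (h (C / 2) (by linarith) (by linarith)).2
      (b.1 ⟨t + C / 2, by simp; linarith⟩)
    refine ⟨u, ext_of_forall fun s => ?_⟩
    obtain ⟨s, hs⟩ := s
    have hs' : t < s := hs
    rcases le_or_gt (t + C / 2) s with hle | hlt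
    · rw [← b.2 ⟨t + C / 2, by simp; linarith⟩ ⟨s, hs⟩ hle, ← hu, Comp.map_map]
      rfl
    · obtain ⟨v, hv⟩ := (h (s - t) (by linarith) (by linarith)).2
        (b.1 ⟨t + (s - t), by simp; linarith⟩)
      have e : v = u := by
        refine (h (C / 2) (by linarith) (by linarith)).1 ?_
        rw [hu, ← b.2 ⟨t + (s - t), by simp; linarith⟩ ⟨t + C / 2, by simp; linarith⟩
          (by simp only; linarith), ← hv, Comp.map_map]
      rw [← b.2 ⟨t + (s - t), by simp; linarith⟩ ⟨s, hs⟩ (by simp), ← hv, Comp.map_map, e]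
      rfl

end Branch

/-- The points `(t, b)` with `b` a component just above the level `t`. -/
abbrev Point (f : X → ℝ) : Type u := Σ t : ℝ, Branch f t

namespace Point

variable {f : X → ℝ}

/-- The point `(t, b)` lies below `(t', b')` if `t ≤ t'` and `b` is sent to `b'`, that is, the
component `b` is contained in the component `b'`. -/
instance : PartialOrder (Point f) where
  le p q := ∃ h : p.1 ≤ q.1, p.2.map h = q.2
  le_refl _ := ⟨le_rfl, rfl⟩
  le_trans p q r := by
    rintro ⟨h, hpq⟩ ⟨h', hqr⟩
    exact ⟨h.trans h', by rw [← hqr, ← hpq]; rfl⟩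
  le_antisymm := by
    rintro ⟨t, b⟩ ⟨t', b'⟩ ⟨h, hpq⟩ ⟨h', -⟩
    obtain rfl : t = t' := le_antisymm h h'
    exact congrArg (Sigma.mk t) hpq

/-- A component which is born at its level: it does not contain a component of a lower level. -/
def IsLeaf (p : Point f) : Prop := ∀ q : Point f, ¬ q < p

/-- A component in which two components of a lower level `s`, distinct at all levels below that
of `p`, merge. -/
def IsMerge (p : Point f) : Prop :=
  ∃ (s : ℝ) (hs : s < p.1) (b b' : Branch f s), b.map hs.le = p.2 ∧ b'.map hs.le = p.2 ∧
    ∀ (r : ℝ) (hr : s ≤ r), r < p.1 → b.map hr ≠ b'.map hr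

end Point

/-- The vertices, other than the root, of the merge tree of `f`. -/
abbrev Vertex (f : X → ℝ) : Type u := {p : Point f // p.IsLeaf ∨ p.IsMerge}

/-- `w` is the lowest vertex above `v`. -/
def Vertex.IsFather {f : X → ℝ} (v w : Vertex f) : Prop :=
  v < w ∧ ∀ u : Vertex f, v < u → w ≤ u

/-! ### Well-definedness of the merge tree -/

section Lemmas

variable {f : X → ℝ} {S : Finset ℝ}

theorem exists_gap (S : Finset ℝ) (t : ℝ) : ∃ r > t, ∀ s ∈ S, t < s → r < s := by
  induction S using Finset.induction_on with
  | empty => exact ⟨t + 1, by linarith, by simp⟩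
  | insert a S _ ih =>
    obtain ⟨r, hr, h⟩ := ih
    rcases lt_or_ge t a with hta | hat
    · refine ⟨min r ((t + a) / 2), lt_min hr (by linarith), fun s hs hts => ?_⟩
      rcases Finset.mem_insert.mp hs with rfl | hs
      · exact (min_le_right _ _).trans_lt (by linarith)
      · exact (min_le_left _ _).trans_lt (h s hs hts)
    · refine ⟨r, hr, fun s hs hts => ?_⟩
      rcases Finset.mem_insert.mp hs with rfl | hs
      · exact absurd hts (not_lt.mpr hat)
      · exact h s hs hts

theorem Branch.map_bijective (hS : IsCriticalSet f S) {t t' : ℝ} (h : t ≤ t')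
    (hfree : ∀ s ∈ S, ¬ (t < s ∧ s ≤ t')) :
    Function.Bijective (Branch.map h : Branch f t → Branch f t') := by
  obtain ⟨m, hm, hgap⟩ := exists_gap S t'
  have hbij : ∀ s (_ : t < s) (hsm : s ≤ m), Function.Bijective (Comp.map f hsm) := by
    intro s hs hsm
    refine hS.bijective _ _ _ fun a ha hab => ?_
    rcases le_or_gt a t' with h1 | h1
    · exact hfree a ha ⟨hs.trans_le hab.1, h1⟩
    · exact absurd (hgap a ha h1) (not_lt.mpr hab.2)
  constructor
  · intro b b' hbb
    refine Branch.ext_of_forall fun s => ?_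
    obtain ⟨s, hs⟩ := s
    have hs' : t < s := hs
    have key : ∀ r (hr : t' < r), b.1 ⟨r, h.trans_lt hr⟩ = b'.1 ⟨r, h.trans_lt hr⟩ :=
      fun r hr => congrArg (fun c : Branch f t' => c.1 ⟨r, hr⟩) hbb
    rcases le_or_gt s m with hle | hlt
    · refine (hbij s hs' hle).1 ?_
      rw [b.2 ⟨s, hs⟩ ⟨m, h.trans_lt hm⟩ hle, b'.2 ⟨s, hs⟩ ⟨m, h.trans_lt hm⟩ hle]
      exact key m hm
    · exact key s (hm.trans hlt)
  · intro c
    have hex : ∀ s : Set.Ioi t, ∃ u : Comp f s.1,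
        (∀ hsm : s.1 ≤ m, Comp.map f hsm u = c.1 ⟨m, hm⟩) ∧
        (∀ hms : m ≤ s.1, u = Comp.map f hms (c.1 ⟨m, hm⟩)) := by
      rintro ⟨s, hs⟩
      rcases le_or_gt s m with hle | hlt
      · obtain ⟨u, hu⟩ := (hbij s hs hle).2 (c.1 ⟨m, hm⟩)
        refine ⟨u, fun _ => hu, fun hms => ?_⟩
        obtain rfl : s = m := le_antisymm hle hms
        rw [Comp.map_self] at hu ⊢
        exact hu
      · exact ⟨Comp.map f hlt.le (c.1 ⟨m, hm⟩), fun h' => absurd hlt (not_lt.mpr h'),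
          fun _ => rfl⟩
    choose u hu1 hu2 using hex
    refine ⟨⟨u, fun r s hrs => ?_⟩, Branch.ext_of_forall fun s => ?_⟩
    · rcases le_or_gt s.1 m with hle | hlt
      · refine (hbij s.1 s.2 hle).1 ?_
        rw [Comp.map_map, hu1 r (hrs.trans hle), hu1 s hle]
      · rcases le_or_gt r.1 m with hle' | hlt'
        · rw [hu2 s hlt.le, ← hu1 r hle', Comp.map_map]
        · rw [hu2 s hlt.le, hu2 r hlt'.le, Comp.map_map]
    · obtain ⟨s, hs⟩ := s
      have hs' : t' < s := hs
      change u ⟨s, h.trans_lt hs'⟩ = c.1 ⟨s, hs⟩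
      rcases le_or_gt s m with hle | hlt
      · refine (hbij s (h.trans_lt hs') hle).1 ?_
        rw [hu1 ⟨s, h.trans_lt hs'⟩ hle]
        exact (c.2 ⟨s, hs⟩ ⟨m, hm⟩ hle).symm
      · rw [hu2 ⟨s, h.trans_lt hs'⟩ hlt.le]
        exact c.2 ⟨m, hm⟩ ⟨s, hs⟩ hlt.le

theorem exists_mem_le (hS : IsCriticalSet f S) (p : Point f) : ∃ s ∈ S, s ≤ p.1 := by
  by_contra! hcon
  obtain ⟨m, hm, hgap⟩ := exists_gap S p.1
  refine Quotient.inductionOn' (p.2.1 ⟨m, hm⟩) fun x => ?_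
  exact hS.empty_below m (fun s hs => hgap s hs (hcon s hs)) x.1 x.2

theorem exists_max_mem_le (hS : IsCriticalSet f S) (p : Point f) :
    ∃ s ∈ S, s ≤ p.1 ∧ ∀ a ∈ S, ¬ (s < a ∧ a ≤ p.1) := by
  obtain ⟨s, hs, hsp⟩ := exists_mem_le hS p
  obtain ⟨c, hc, hmax⟩ := (S.filter (· ≤ p.1)).exists_max_image id
    ⟨s, Finset.mem_filter.mpr ⟨hs, hsp⟩⟩
  rw [Finset.mem_filter] at hc
  exact ⟨c, hc.1, hc.2, fun a ha hca =>
    absurd (hmax a (Finset.mem_filter.mpr ⟨ha, hca.2⟩)) (not_le.mpr hca.1)⟩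

theorem exists_le_of_point (hS : IsCriticalSet f S) (p : Point f) : ∃ q ≤ p, q.1 ∈ S := by
  obtain ⟨s, hs, hsp, hfree⟩ := exists_max_mem_le hS p
  obtain ⟨b, hb⟩ := (Branch.map_bijective hS hsp hfree).2 p.2
  exact ⟨⟨s, b⟩, ⟨hsp, hb⟩, hs⟩

theorem Point.fst_lt {p q : Point f} (h : p < q) : p.1 < q.1 := by
  obtain ⟨⟨h1, h2⟩, h3⟩ := h
  rcases h1.lt_or_eq with h4 | h4
  · exact h4
  · obtain ⟨t, b⟩ := p
    obtain ⟨t', b'⟩ := q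
    obtain rfl : t = t' := h4
    exact absurd ⟨le_rfl, h2.symm⟩ h3

theorem Point.le_of_le_of_le {p q r : Point f} (hq : p ≤ q) (hr : p ≤ r) (h : q.1 ≤ r.1) :
    q ≤ r := by
  obtain ⟨h1, h2⟩ := hq
  obtain ⟨h3, h4⟩ := hr
  exact ⟨h, by rw [← h2, ← h4]; rfl⟩

/-- Every component contains one which is a leaf. -/
theorem exists_leaf_le (hS : IsCriticalSet f S) (p : Point f) : ∃ q ≤ p, q.IsLeaf := by
  classical
  obtain ⟨q, hq, hqS⟩ := exists_le_of_point hS p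
  obtain ⟨c, hc, hmin⟩ := (S.filter fun s => ∃ q ≤ p, q.1 = s).exists_min_image id
    ⟨q.1, Finset.mem_filter.mpr ⟨hqS, q, hq, rfl⟩⟩
  obtain ⟨-, q', hq', rfl⟩ := Finset.mem_filter.mp hc
  refine ⟨q', hq', fun r hr => ?_⟩
  obtain ⟨r', hr', hrS⟩ := exists_le_of_point hS r
  have h1 := hmin r'.1 (Finset.mem_filter.mpr ⟨hrS, r', hr'.trans (hr.le.trans hq'), rfl⟩)
  exact absurd (Point.fst_lt (hr'.trans_lt hr)) (not_lt.mpr h1)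

/-- Every vertex lies at a critical value. -/
theorem Vertex.fst_mem (hS : IsCriticalSet f S) (v : Vertex f) : v.1.1 ∈ S := by
  obtain ⟨c, hc, hcp, hfree⟩ := exists_max_mem_le hS v.1
  rcases hcp.lt_or_eq with hlt | heq
  · exfalso
    rcases v.2 with hl | ⟨s, hs, b, b', hb, hb', hne⟩
    · obtain ⟨q, hq⟩ := (Branch.map_bijective hS hcp hfree).2 v.1.2
      refine hl ⟨c, q⟩ (lt_of_le_of_ne ⟨hcp, hq⟩ fun h => ?_)
      exact hlt.ne (congrArg Sigma.fst h)
    · refine hne (max s c) (le_max_left _ _) (max_lt hs hlt) ?_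
      refine (Branch.map_bijective hS (max_lt hs hlt).le fun a ha hab => ?_).1 (hb.trans hb'.symm)
      exact hfree a ha ⟨(le_max_right _ _).trans_lt hab.1, hab.2⟩
  · rwa [heq] at hc

theorem Branch.finite (hf : IsTame f) (t : ℝ) : Finite (Branch f t) := by
  obtain ⟨S, hS⟩ := hf.exists_criticalSet
  obtain ⟨m, hm, hgap⟩ := exists_gap S t
  have := hf.finite_comp m
  refine Finite.of_injective (fun b : Branch f t => b.1 ⟨m, hm⟩) fun b b' hbb => ?_
  refine Branch.ext_of_forall fun s => ?_
  have hbb' : b.1 ⟨m, hm⟩ = b'.1 ⟨m, hm⟩ := hbb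
  rcases le_or_gt s.1 m with hle | hlt
  · refine (hS.bijective s.1 m hle fun a ha hab => ?_).1 ?_
    · exact absurd (hgap a ha (lt_of_lt_of_le s.2 hab.1)) (not_lt.mpr hab.2)
    · rw [b.2 s ⟨m, hm⟩ hle, b'.2 s ⟨m, hm⟩ hle, hbb']
  · rw [← b.2 ⟨m, hm⟩ s hlt.le, ← b'.2 ⟨m, hm⟩ s hlt.le, hbb']

theorem Vertex.finite (hf : IsTame f) : Finite (Vertex f) := by
  obtain ⟨S, hS⟩ := hf.exists_criticalSet
  have := fun s : S => Branch.finite hf s.1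
  refine Finite.of_injective
    (fun v : Vertex f => (⟨⟨v.1.1, v.fst_mem hS⟩, v.1.2⟩ : Σ s : S, Branch f s.1)) ?_
  rintro ⟨⟨t, b⟩, hv⟩ ⟨⟨t', b'⟩, hv'⟩ h
  simp only [Sigma.mk.injEq, Subtype.mk.injEq] at h
  obtain ⟨rfl, h⟩ := h
  obtain rfl := eq_of_heq h
  rfl

theorem Vertex.exists_isFather (hf : IsTame f) {v w : Vertex f} (h : v < w) :
    ∃ u, Vertex.IsFather v u := by
  have := Vertex.finite hf
  obtain ⟨u, hu, hmin⟩ := Set.exists_min_image {u : Vertex f | v < u} (fun u => u.1.1)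
    (Set.toFinite _) ⟨w, h⟩
  refine ⟨u, hu, fun u' hu' => ?_⟩
  exact Point.le_of_le_of_le (p := v.1) (le_of_lt hu) (le_of_lt hu') (hmin u' hu')

theorem subsingleton_branch [PathConnectedSpace X] {K : ℝ} (hK : ∀ x, f x ≤ K) :
    Subsingleton (Branch f K) := by
  refine ⟨fun b b' => Branch.ext_of_forall fun s => ?_⟩
  refine Quotient.inductionOn₂' (b.1 s) (b'.1 s) fun x y => ?_
  have hj : Joined x.1 y.1 := PathConnectedSpace.joined x.1 y.1
  refine Quotient.sound' ?_
  have hc : Continuous fun z : X => (⟨z, (hK z).trans (le_of_lt s.2)⟩ : {x : X // f x ≤ s.1}) := by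
    fun_prop
  exact hj.map hc

/-- Two components none of which contains the other merge in a vertex above both. -/
theorem exists_vertex_above [PathConnectedSpace X] (hf : IsTame f)
    (hb : BddAbove (Set.range f)) (p q : Point f) (hpq : ¬ p ≤ q) (hqp : ¬ q ≤ p) :
    ∃ v : Vertex f, p < v.1 ∧ q < v.1 := by
  classical
  obtain ⟨S, hS⟩ := hf.exists_criticalSet
  obtain ⟨K, hK⟩ := hb
  set m := max p.1 q.1 with hm
  have hpm : p.1 ≤ m := le_max_left _ _
  have hqm : q.1 ≤ m := le_max_right _ _
  have hne : p.2.map hpm ≠ q.2.map hqm := by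
    intro he
    rcases le_total p.1 q.1 with h | h
    · have hmq : m = q.1 := max_eq_right h
      refine hpq (le_trans (b := (⟨m, p.2.map hpm⟩ : Point f)) ⟨hpm, rfl⟩ ?_)
      rw [he]
      exact ⟨hmq.le, rfl⟩
    · have hmp : m = p.1 := max_eq_left h
      refine hqp (le_trans (b := (⟨m, q.2.map hqm⟩ : Point f)) ⟨hqm, rfl⟩ ?_)
      rw [← he]
      exact ⟨hmp.le, rfl⟩
  have step : ∀ r (hr : m ≤ r), p.2.map (hpm.trans hr) = q.2.map (hqm.trans hr) →
      ∃ c ∈ S, c ≤ r ∧ ∃ hc : m < c, p.2.map (hpm.trans hc.le) = q.2.map (hqm.trans hc.le) := by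
    intro r hr he
    obtain ⟨c, hc, hcr, hfree⟩ := exists_max_mem_le hS ⟨r, p.2.map (hpm.trans hr)⟩
    have hcr' : c ≤ r := hcr
    rcases lt_or_ge m c with hmc | hcm
    · exact ⟨c, hc, hcr, hmc, (Branch.map_bijective hS hcr' hfree).1 he⟩
    · exact absurd ((Branch.map_bijective hS hr fun a ha hab =>
        hfree a ha ⟨hcm.trans_lt hab.1, hab.2⟩).1 he) hne
  have hsub : Subsingleton (Branch f (max m K)) :=
    subsingleton_branch fun x => (hK ⟨x, rfl⟩).trans (le_max_right _ _)
  obtain ⟨c0, hc0, -, hc0'⟩ := step (max m K) (le_max_left _ _) (Subsingleton.elim _ _)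
  obtain ⟨c, hc, hmin⟩ := (S.filter fun c => ∃ hc : m < c,
    p.2.map (hpm.trans hc.le) = q.2.map (hqm.trans hc.le)).exists_min_image id
    ⟨c0, Finset.mem_filter.mpr ⟨hc0, hc0'⟩⟩
  obtain ⟨hcS, hmc, he⟩ := Finset.mem_filter.mp hc
  have hmerge : Point.IsMerge (⟨c, p.2.map (hpm.trans hmc.le)⟩ : Point f) := by
    refine ⟨m, hmc, p.2.map hpm, q.2.map hqm, rfl, he.symm, fun r hr hrc her => ?_⟩
    obtain ⟨c', hc', hcr', hmc', he'⟩ := step r hr her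
    have h1 : c ≤ c' := hmin c' (Finset.mem_filter.mpr ⟨hc', hmc', he'⟩)
    have h2 : r < c := hrc
    linarith
  refine ⟨⟨_, Or.inr hmerge⟩, lt_of_le_of_ne ⟨hpm.trans hmc.le, rfl⟩ fun h => ?_,
    lt_of_le_of_ne ⟨hqm.trans hmc.le, he.symm⟩ fun h => ?_⟩
  · have h1 : p.1 = c := congrArg Sigma.fst h
    linarith
  · have h1 : q.1 = c := congrArg Sigma.fst h
    linarith

end Lemmas

open Classical in
/-- The father of a vertex in the merge tree of `f`, where the root is `none`: the lowest vertex
above it if there is one, and otherwise the root. -/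
noncomputable def father (f : X → ℝ) : Option (Vertex f) → Option (Vertex f)
  | none => none
  | some v => if h : ∃ w, Vertex.IsFather v w then some h.choose else none

/-- The height of a vertex `(t, b)` is `t`; the height of the root `none` is `+∞`. -/
def vertexHeight (f : X → ℝ) : Option (Vertex f) → WithTop ℝ
  | none => ⊤
  | some v => (v.1.1 : WithTop ℝ)

theorem vertexHeight_lt_father (f : X → ℝ) (v : Option (Vertex f)) (hv : v ≠ none) :
    vertexHeight f v < vertexHeight f (father f v) := by
  cases v with
  | none => exact absurd rfl hv
  | some v =>
    by_cases h : ∃ w, Vertex.IsFather v w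
    · have : father f (some v) = some h.choose := by simp [father, h]
      rw [this]
      exact WithTop.coe_lt_coe.mpr (Point.fst_lt h.choose_spec.1)
    · have : father f (some v) = none := by simp [father, h]
      rw [this]
      exact WithTop.coe_lt_top _

theorem father_eq_none_iff {f : X → ℝ} (hf : IsTame f) (v : Vertex f) :
    father f (some v) = none ↔ ∀ w, ¬ v < w := by
  by_cases h : ∃ w, Vertex.IsFather v w
  · simp only [father, h, dif_pos]
    simp only [reduceCtorEq, false_iff, not_forall, not_not]
    exact ⟨_, h.choose_spec.1⟩
  · simp only [father, h, dif_neg, not_false_eq_true, true_iff]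
    exact fun w hw => h (Vertex.exists_isFather hf hw)

/-- The merge tree `T_f` of a tame function `f`, bounded above, on a path connected space. Besides
the root it has one vertex, at height `t`, for every component just above the level `t` which is
born at `t` or in which several components merge at `t`. -/
noncomputable def mergeTree [PathConnectedSpace X] (f : X → ℝ) (hf : IsTame f)
    (hb : BddAbove (Set.range f)) : MergeTree.{u} where
  V := Option (Vertex f)
  fintype := by
    have := Vertex.finite hf
    exact Fintype.ofFinite _
  root := none
  parent := father f
  parent_root := rfl
  reaches_root v := by
    have := Vertex.finite hf
    have hwf : WellFounded fun a b : Option (Vertex f) => vertexHeight f b < vertexHeight f a := by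
      have : IsTrans (Option (Vertex f)) fun a b => vertexHeight f b < vertexHeight f a :=
        ⟨fun _ _ _ h h' => h'.trans h⟩
      have : Std.Irrefl fun a b : Option (Vertex f) => vertexHeight f b < vertexHeight f a :=
        ⟨fun _ => lt_irrefl _⟩
      exact Finite.wellFounded_of_trans_of_irrefl _
    induction v using hwf.induction with
    | h v ih =>
      by_cases hv : v = none
      · exact ⟨0, hv⟩
      · obtain ⟨n, hn⟩ := ih (father f v) (vertexHeight_lt_father f v hv)
        exact ⟨n + 1, by rw [Function.iterate_succ_apply]; exact hn⟩
  height := vertexHeight f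
  height_root := rfl
  height_ne_top v hv := by
    cases v with
    | none => exact absurd rfl hv
    | some v => exact WithTop.coe_ne_top
  height_lt_parent := vertexHeight_lt_father f
  root_order_one := by
    have := Vertex.finite hf
    obtain ⟨S, hS⟩ := hf.exists_criticalSet
    obtain ⟨x⟩ : Nonempty X := inferInstance
    obtain ⟨l, -, hl⟩ := exists_leaf_le hS
      (⟨f x, Branch.ofComp (ZerothHomotopy.mk ⟨x, le_rfl⟩)⟩ : Point f)
    obtain ⟨v, -, hv⟩ := Set.exists_max_image (Set.univ : Set (Vertex f)) (fun u => u.1.1)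
      (Set.toFinite _) ⟨⟨l, Or.inl hl⟩, trivial⟩
    have hvm : ∀ w, ¬ v < w := fun w hw =>
      absurd (Point.fst_lt (p := v.1) (q := w.1) hw) (not_lt.mpr (hv w trivial))
    refine ⟨some v, ⟨Option.some_ne_none v, (father_eq_none_iff hf v).mpr hvm⟩, ?_⟩
    rintro w ⟨hw, hw'⟩
    cases w with
    | none => exact absurd rfl hw
    | some w =>
      have hwm := (father_eq_none_iff hf w).mp hw'
      by_cases h1 : v.1 ≤ w.1
      · rcases h1.lt_or_eq with h2 | h2
        · exact absurd h2 (hvm w)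
        · rw [Subtype.ext h2]
      · by_cases h2 : w.1 ≤ v.1
        · rcases h2.lt_or_eq with h3 | h3
          · exact absurd h3 (hwm v)
          · rw [Subtype.ext h3]
        · obtain ⟨u, hu, -⟩ := exists_vertex_above hf hb v.1 w.1 h1 h2
          exact absurd hu (hvm u)

end Filtration

end MergeTrees

/-!
Two trees with heights are compared through common marked vertices. If `g ≤ f + ε` and `f ≤ g + ε`,
every component of `f` at level `t` lies in a component of `g` at level `t + ε`, and conversely
(`Point.transfer`); going back and forth leads from a component to one above it. Among the images
of the leaves of `f` take the minimal ones, one leaf of `f` for each and a leaf of `g` below it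
(`LeafMatching`). Minimality has three consequences: the heights of corresponding leaves differ by
at most `ε`, the levels at which two of them merge differ by at most `ε` (`exists_vertex_right`,
`exists_vertex_left`), and every branch without selected leaves has only edges of length at most
`2ε` (`exists_vertex_gt_left`, `exists_vertex_gt_right`).

The rest concerns finite trees. The cluster of a vertex `v` is the set of marked vertices below it.
A tree `T` with marked vertices spans a tree whose vertices are the root and, for each nonempty
cluster, the lowest vertex with this cluster (the essential vertices). To get there from `T`, the
vertices above no marked vertex are deleted and the remaining vertices that have a child with the
same cluster are ghosted. The height of an essential vertex with cluster `C` is the largest height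
at which two, possibly equal, marked vertices of `C` come together. The height of its father in the spanned tree is
the least height at which one of `C` and one outside `C` come together, or that of the root if `C`
contains all marked vertices. Hence heights belonging to the same cluster in both trees differ by at
most `ε` (`height_le_of_cluster_eq`, `height_next_le_of_cluster_eq`), and a cluster that occurs in
one tree only belongs to an edge of length at most `2ε` (`exists_cluster_eq`). Such edges are
deleted (`exists_reduction`). Since deletions leave the other weights unchanged, the weights of the
surviving edges in the two trees still differ by at most `2ε`, and shrinking them makes the trees
isomorphic.
Every vertex of either tree is touched by at most one edit.
-/

namespace MergeTrees

/-! ### The ancestor order of a rooted tree -/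

namespace RootedTree

variable {T : RootedTree.{u}}

/-- `T.Le u v`: the vertex `v` is `u` or an ancestor of `u`. -/
def Le (T : RootedTree.{u}) (u v : T.V) : Prop := ∃ n : ℕ, T.parent^[n] u = v

theorem Le.refl (u : T.V) : T.Le u u := ⟨0, rfl⟩

theorem Le.trans {u v w : T.V} (h : T.Le u v) (h' : T.Le v w) : T.Le u w := by
  obtain ⟨n, rfl⟩ := h
  obtain ⟨m, rfl⟩ := h'
  exact ⟨m + n, Function.iterate_add_apply _ _ _ _⟩

theorem le_root (u : T.V) : T.Le u T.root := T.reaches_root u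

theorem le_parent (u : T.V) : T.Le u (T.parent u) := ⟨1, rfl⟩

theorem iterate_parent_root (n : ℕ) : T.parent^[n] T.root = T.root :=
  Function.iterate_fixed T.parent_root n

theorem eq_root_of_root_le {u : T.V} (h : T.Le T.root u) : u = T.root := by
  obtain ⟨n, rfl⟩ := h
  exact iterate_parent_root n

/-- A vertex on a cycle of the father map is the root. -/
theorem eq_root_of_iterate_eq {u : T.V} {n : ℕ} (hn : 0 < n) (h : T.parent^[n] u = u) :
    u = T.root := by
  obtain ⟨k, hk⟩ := T.reaches_root u
  have h1 : T.parent^[n * k] u = u := by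
    rw [Function.iterate_mul]
    exact Function.iterate_fixed h k
  have h2 : k ≤ n * k := Nat.le_mul_of_pos_left k hn
  rw [← Nat.sub_add_cancel h2, Function.iterate_add_apply, hk, iterate_parent_root] at h1
  exact h1.symm

theorem Le.antisymm {u v : T.V} (h : T.Le u v) (h' : T.Le v u) : u = v := by
  obtain ⟨n, hn⟩ := h
  obtain ⟨m, hm⟩ := h'
  rcases Nat.eq_zero_or_pos n with rfl | hpos
  · exact hn
  · have hu : u = T.root := by
      refine eq_root_of_iterate_eq (n := m + n) (by omega) ?_
      rw [Function.iterate_add_apply, hn, hm]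
    rw [← hn, hu, iterate_parent_root]

theorem le_iff {u v : T.V} : T.Le u v ↔ u = v ∨ T.Le (T.parent u) v := by
  constructor
  · rintro ⟨n, hn⟩
    cases n with
    | zero => exact Or.inl hn
    | succ n => exact Or.inr ⟨n, hn⟩
  · rintro (rfl | h)
    · exact Le.refl _
    · exact (le_parent u).trans h

theorem parent_le_of_le_of_ne {u v : T.V} (h : T.Le u v) (hne : u ≠ v) : T.Le (T.parent u) v :=
  (le_iff.mp h).resolve_left hne

theorem parent_ne {u : T.V} (hu : u ≠ T.root) : T.parent u ≠ u := fun h =>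
  hu (eq_root_of_iterate_eq (n := 1) one_pos h)

/-- The ancestors of a vertex form a chain. -/
theorem Le.total {u v w : T.V} (h : T.Le u v) (h' : T.Le u w) : T.Le v w ∨ T.Le w v := by
  obtain ⟨n, rfl⟩ := h
  obtain ⟨m, rfl⟩ := h'
  rcases le_total n m with hle | hle
  · exact Or.inl ⟨m - n, by rw [← Function.iterate_add_apply, Nat.sub_add_cancel hle]⟩
  · exact Or.inr ⟨n - m, by rw [← Function.iterate_add_apply, Nat.sub_add_cancel hle]⟩

/-- Below a proper ancestor `v` of `u` there is a child of `v` on the way down to `u`. -/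
theorem exists_child {u v : T.V} (h : T.Le u v) (hne : u ≠ v) :
    ∃ c, c ≠ T.root ∧ T.parent c = v ∧ T.Le u c := by
  classical
  have hex : ∃ n, T.parent^[n] u = v := h
  obtain ⟨n, hn⟩ : ∃ n, Nat.find hex = n + 1 := Nat.exists_eq_succ_of_ne_zero fun h0 =>
    hne (by simpa [h0] using Nat.find_spec hex)
  have hv : T.parent (T.parent^[n] u) = v := by
    have h1 := Nat.find_spec hex
    rwa [hn, Function.iterate_succ_apply'] at h1
  refine ⟨T.parent^[n] u, fun hr => ?_, hv, n, rfl⟩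
  refine Nat.find_min hex (m := n) (by omega) ?_
  rw [← hv, hr, T.parent_root]

/-- The father is the least proper ancestor. -/
theorem parent_eq_of_forall_le {u p : T.V} (hp : T.Le u p) (hne : u ≠ p)
    (h : ∀ q, T.Le u q → u ≠ q → T.Le p q) : T.parent u = p := by
  refine (parent_le_of_le_of_ne hp hne).antisymm (h _ (le_parent u) fun he => hne ?_)
  by_cases hu : u = T.root
  · rw [hu] at hp ⊢
    exact (eq_root_of_root_le hp).symm
  · exact absurd he.symm (parent_ne hu)

/-- A bijection that preserves and reflects the ancestor order preserves the root and fathers. -/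
theorem map_root_and_parent {S : RootedTree.{u}} (e : T.V ≃ S.V)
    (he : ∀ u v, S.Le (e u) (e v) ↔ T.Le u v) :
    e T.root = S.root ∧ ∀ u, e (T.parent u) = S.parent (e u) := by
  have hr : e T.root = S.root := by
    refine (le_root (T := S) _).antisymm ?_
    rw [← e.apply_symm_apply S.root, he]
    exact le_root _
  refine ⟨hr, fun u => ?_⟩
  by_cases hu : u = T.root
  · rw [hu, T.parent_root, hr, S.parent_root]
  refine (parent_eq_of_forall_le ((he _ _).mpr (le_parent u))
    (fun h => parent_ne hu (e.injective h).symm) fun q hq hne => ?_).symm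
  rw [← e.apply_symm_apply q, he] at hq ⊢
  refine parent_le_of_le_of_ne hq ?_
  rintro rfl
  simp at hne

/-! ### Removing one vertex -/

section Remove

variable (T) (v : T.V)

open Classical in
/-- The father map after removing `v`: the children of `v` are attached to the father of `v`. -/
noncomputable def removeParent (hv : v ≠ T.root) (u : {u : T.V // u ≠ v}) : {u : T.V // u ≠ v} :=
  if h : T.parent u.1 = v then ⟨T.parent v, parent_ne hv⟩ else ⟨T.parent u.1, h⟩

/-- Ancestors in `T` remain ancestors after removing `v`: a step of `removeParent` makes one step in
`T`, or two in order to skip `v`. -/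
theorem exists_iterate_removeParent (hv : v ≠ T.root) (n : ℕ) :
    ∀ u w : {u : T.V // u ≠ v}, T.parent^[n] u.1 = w.1 →
      ∃ m, (removeParent T v hv)^[m] u = w := by
  induction n using Nat.strong_induction_on with
  | h n ih =>
    intro u w h
    cases n with
    | zero => exact ⟨0, Subtype.ext h⟩
    | succ n =>
      rw [Function.iterate_succ_apply] at h
      by_cases hu : T.parent u.1 = v
      · cases n with
        | zero => exact absurd (h.symm.trans hu) w.2
        | succ n =>
          rw [Function.iterate_succ_apply, hu] at h
          obtain ⟨m, hm⟩ := ih n (by omega) ⟨T.parent v, parent_ne hv⟩ w h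
          refine ⟨m + 1, ?_⟩
          rw [Function.iterate_succ_apply, removeParent, dif_pos hu, hm]
      · obtain ⟨m, hm⟩ := ih n (by omega) ⟨T.parent u.1, hu⟩ w h
        refine ⟨m + 1, ?_⟩
        rw [Function.iterate_succ_apply, removeParent, dif_neg hu, hm]

open Classical in
/-- The tree with the vertex `v`, not the root, removed. -/
noncomputable def remove (hv : v ≠ T.root) : RootedTree.{u} where
  V := {u : T.V // u ≠ v}
  fintype := inferInstance
  root := ⟨T.root, hv.symm⟩
  parent := removeParent T v hv
  parent_root := by
    have h : T.parent T.root ≠ v := by rw [T.parent_root]; exact hv.symm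
    rw [removeParent, dif_neg h]
    exact Subtype.ext T.parent_root
  reaches_root u := by
    obtain ⟨n, hn⟩ := T.reaches_root u.1
    exact exists_iterate_removeParent T v hv n u ⟨T.root, hv.symm⟩ hn

/-- The vertices of `T.remove v hv` as vertices of `T`. -/
def removeVal (hv : v ≠ T.root) (u : (T.remove v hv).V) : T.V := u.1

theorem removeVal_injective (hv : v ≠ T.root) : Function.Injective (removeVal T v hv) :=
  Subtype.val_injective

theorem range_removeVal (hv : v ≠ T.root) : Set.range (removeVal T v hv) = {v}ᶜ :=
  Subtype.range_coe_subtype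

open Classical in
theorem removeVal_parent (hv : v ≠ T.root) (u : (T.remove v hv).V) :
    removeVal T v hv ((T.remove v hv).parent u) =
      if T.parent (removeVal T v hv u) = v then T.parent v else T.parent (removeVal T v hv u) := by
  change (removeParent T v hv u).1 = if T.parent u.1 = v then _ else T.parent u.1
  unfold removeParent
  split_ifs <;> rfl

theorem removeVal_le_iff (hv : v ≠ T.root) (u w : (T.remove v hv).V) :
    T.Le (removeVal T v hv u) (removeVal T v hv w) ↔ (T.remove v hv).Le u w := by
  constructor
  · rintro ⟨n, hn⟩
    exact exists_iterate_removeParent T v hv n u w hn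
  · rintro ⟨n, hn⟩
    induction n generalizing u with
    | zero =>
      have : u = w := hn
      rw [this]
      exact Le.refl _
    | succ n ih =>
      refine Le.trans ?_ (ih ((T.remove v hv).parent u) hn)
      rw [removeVal_parent]
      split_ifs with h
      · refine (le_parent (removeVal T v hv u)).trans ?_
        rw [h]
        exact le_parent v
      · exact le_parent _

open Classical in
theorem card_remove (hv : v ≠ T.root) :
    Fintype.card (T.remove v hv).V + 1 = Fintype.card T.V := by
  have h := Fintype.card_subtype_compl (fun u : T.V => u = v)
  have h1 : 0 < Fintype.card T.V := Fintype.card_pos_iff.mpr ⟨v⟩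
  have h2 : Fintype.card (T.remove v hv).V = Fintype.card {u : T.V // ¬ u = v} :=
    Fintype.card_congr (Equiv.refl _)
  rw [h2, h, Fintype.card_subtype_eq]
  omega

end Remove

end RootedTree
end MergeTrees

namespace MergeTrees

/-! ### Edit paths up to isomorphism -/

namespace WeightedTree

theorem IsIso.refl (T : WeightedTree.{u}) : IsIso T T :=
  ⟨Equiv.refl _, rfl, fun _ => rfl, fun _ _ => rfl⟩

theorem IsIso.symm {T S : WeightedTree.{u}} (h : IsIso T S) : IsIso S T := by
  obtain ⟨e, hr, hp, hw⟩ := h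
  refine ⟨e.symm, ?_, fun u => ?_, fun u hu => ?_⟩
  · rw [← hr, e.symm_apply_apply]
  · rw [e.symm_apply_eq, hp, e.apply_symm_apply]
  · rw [← hw _ fun h => hu (by rw [← hr, ← h, e.apply_symm_apply]), e.apply_symm_apply]

theorem IsIso.trans {T S R : WeightedTree.{u}} (h : IsIso T S) (h' : IsIso S R) : IsIso T R := by
  obtain ⟨e, hr, hp, hw⟩ := h
  obtain ⟨e', hr', hp', hw'⟩ := h'
  refine ⟨e.trans e', ?_, fun u => ?_, fun u hu => ?_⟩
  · simp [hr, hr']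
  · simp [hp, hp']
  · rw [Equiv.trans_apply, hw' _ fun h => hu (e.injective (h.trans hr.symm)), hw u hu]

open Classical in
theorem RemovesVertex.congr {T S T' S' : WeightedTree.{u}} {v : T.V} {ι : S.V → T.V}
    (h : RemovesVertex T S v ι) (e : T.V ≃ T'.V) (hr : e T.root = T'.root)
    (hp : ∀ u, e (T.parent u) = T'.parent (e u)) (e' : S'.V ≃ S.V) (hr' : e' S'.root = S.root)
    (hp' : ∀ u, e' (S'.parent u) = S.parent (e' u)) :
    RemovesVertex T' S' (e v) (fun u => e (ι (e' u))) := by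
  obtain ⟨hv, hinj, hrange, hroot, hpar⟩ := h
  refine ⟨fun h => hv (e.injective (h.trans hr.symm)), fun a b hab => ?_, ?_, ?_, fun u => ?_⟩
  · exact e'.injective (hinj (e.injective hab))
  · ext x
    have h1 : e.symm x ∈ Set.range ι ↔ e.symm x ∈ ({v}ᶜ : Set T.V) := by rw [hrange]
    simp only [Set.mem_range, Set.mem_compl_iff, Set.mem_singleton_iff] at h1 ⊢
    rw [← e.symm_apply_eq, ← h1]
    constructor
    · rintro ⟨y, rfl⟩
      exact ⟨e' y, by simp⟩
    · rintro ⟨y, hy⟩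
      exact ⟨e'.symm y, by simp [hy]⟩
  · simp only [hr', hroot, hr]
  · change e (ι (e' (S'.parent u))) = if T'.parent (e (ι (e' u))) = e v then T'.parent (e v)
      else T'.parent (e (ι (e' u)))
    rw [hp', hpar, ← hp, ← hp]
    by_cases h : T.parent (ι (e' u)) = v
    · rw [if_pos h, if_pos (congrArg e h)]
    · rw [if_neg h, if_neg fun h' => h (e.injective h')]

theorem IsDeletion.congr {T S T' S' : WeightedTree.{u}} {v : T.V} (h : IsDeletion T S v)
    (hT : IsIso T T') (hS : IsIso S S') :
    ∃ v', IsDeletion T' S' v' ∧ T'.weight v' = T.weight v := by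
  obtain ⟨ι, hι, hw⟩ := h
  obtain ⟨e, hr, hp, he⟩ := hT
  obtain ⟨e', hr', hp', he'⟩ := hS.symm
  refine ⟨e v, ⟨_, hι.congr e hr hp e' hr' hp', fun u hu => ?_⟩, he v hι.1⟩
  have hu' : e' u ≠ S.root := fun h => hu (e'.injective (h.trans hr'.symm))
  have hu'' : ι (e' u) ≠ T.root := fun h => hu' (hι.2.1 (h.trans hι.2.2.2.1.symm))
  rw [← he' u hu, hw _ hu', he _ hu'']

theorem IsGhosting.congr {T S T' S' : WeightedTree.{u}} {v : T.V} (h : IsGhosting T S v)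
    (hT : IsIso T T') (hS : IsIso S S') : ∃ v', IsGhosting T' S' v' := by
  obtain ⟨c, ι, hc, hι, hw⟩ := h
  obtain ⟨e, hr, hp, he⟩ := hT
  obtain ⟨e', hr', hp', he'⟩ := hS.symm
  refine ⟨e v, e c, _, fun u => ?_, hι.congr e hr hp e' hr' hp', fun u hu => ?_⟩
  · rw [← e.apply_symm_apply u, ← hp, ← hr]
    simp only [ne_eq, e.apply_eq_iff_eq]
    exact hc _
  have hu' : e' u ≠ S.root := fun h => hu (e'.injective (h.trans hr'.symm))
  have hu'' : ι (e' u) ≠ T.root := fun h => hu' (hι.2.1 (h.trans hι.2.2.2.1.symm))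
  have hc' : c ≠ T.root := ((hc c).mpr rfl).1
  rw [← he' u hu, hw _ hu', he _ hu'', he _ hc', he _ hι.1]
  by_cases h : ι (e' u) = c
  · rw [if_pos h, if_pos (congrArg e h)]
  · rw [if_neg h, if_neg fun h' => h (e.injective h')]

theorem IsShrinking.congr {T S T' S' : WeightedTree.{u}} {v : T.V} {w : ℝ}
    (h : IsShrinking T S v w) (hT : IsIso T T') (hS : IsIso S S') :
    ∃ v', IsShrinking T' S' v' w ∧ T'.weight v' = T.weight v := by
  obtain ⟨hv, a, har, hap, haw, hav⟩ := h
  obtain ⟨b, hbr, hbp, hbw⟩ := hT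
  obtain ⟨d, hdr, hdp, hdw⟩ := hS
  have hroot : ∀ u, u ≠ T.root → a u ≠ S.root := fun u hu h => hu (a.injective (h.trans har.symm))
  refine ⟨b v, ⟨fun h => hv (b.injective (h.trans hbr.symm)), (b.symm.trans a).trans d, ?_,
    fun u => ?_, fun u hu huv => ?_, ?_⟩, hbw v hv⟩
  · simp [← hbr, har, hdr]
  · obtain ⟨u, rfl⟩ := b.surjective u
    simp [← hbp, hap, hdp]
  · obtain ⟨u, rfl⟩ := b.surjective u
    have h1 : u ≠ T.root := fun h => hu (by rw [h, hbr])
    have h2 : u ≠ v := fun h => huv (by rw [h])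
    simp [hdw _ (hroot u h1), haw u h1 h2, hbw u h1]
  · simp [hdw _ (hroot v hv), hav]

theorem Edit.congr {T S T' S' : WeightedTree.{u}} {c : ℝ} (h : Edit T S c) (hT : IsIso T T')
    (hS : IsIso S S') : Edit T' S' c := by
  cases h with
  | shrink h =>
    obtain ⟨v', h', hw⟩ := h.congr hT hS
    rw [← hw]
    exact .shrink h'
  | delete h =>
    obtain ⟨v', h', hw⟩ := h.congr hT hS
    rw [← hw]
    exact .delete h'
  | insert h =>
    obtain ⟨v', h', hw⟩ := h.congr hS hT
    rw [← hw]
    exact .insert h'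
  | ghost h =>
    obtain ⟨v', h'⟩ := h.congr hT hS
    exact .ghost h'
  | split h =>
    obtain ⟨v', h'⟩ := h.congr hS hT
    exact .split h'

theorem Edit.symm {T S : WeightedTree.{u}} {c : ℝ} (h : Edit T S c) : Edit S T c := by
  cases h with
  | @shrink v w h =>
    obtain ⟨hv, e, hr, hp, hw, hev⟩ := h
    have h1 : IsShrinking S T (e v) (T.weight v) := by
      refine ⟨fun h => hv (e.injective (h.trans hr.symm)), e.symm, ?_, fun u => ?_,
        fun u hu huv => ?_, by simp⟩
      · rw [← hr, e.symm_apply_apply]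
      · rw [e.symm_apply_eq, hp, e.apply_symm_apply]
      · obtain ⟨u, rfl⟩ := e.surjective u
        rw [e.symm_apply_apply, hw u (fun h => hu (by rw [h, hr])) fun h => huv (by rw [h])]
    rw [abs_sub_comm, ← hev]
    exact .shrink h1
  | delete h => exact .insert h
  | insert h => exact .delete h
  | ghost h => exact .split h
  | split h => exact .ghost h

theorem Edit.nonneg {T S : WeightedTree.{u}} {c : ℝ} (h : Edit T S c) : 0 ≤ c := by
  cases h with
  | shrink h => exact abs_nonneg _
  | delete h =>
    obtain ⟨ι, hι, -⟩ := h
    exact (T.weight_pos _ hι.1).le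
  | insert h =>
    obtain ⟨ι, hι, -⟩ := h
    exact (S.weight_pos _ hι.1).le
  | ghost h => exact le_rfl
  | split h => exact le_rfl

theorem EditPath.sum_nonneg {T S : WeightedTree.{u}} {cs : List ℝ} (h : EditPath T S cs) :
    0 ≤ cs.sum := by
  induction h with
  | nil h => simp
  | cons h hs ih =>
    rw [List.sum_cons]
    exact add_nonneg h.nonneg ih

theorem editDist_le {T S : WeightedTree.{u}} {cs : List ℝ} (h : EditPath T S cs) :
    editDist T S ≤ cs.sum := by
  refine csInf_le ⟨0, ?_⟩ ⟨cs, h, rfl⟩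
  rintro _ ⟨ds, hds, rfl⟩
  exact hds.sum_nonneg

/-- There is an edit path from `T` to `S` of at most `n` edits, each of cost at most `c`. -/
def Reaches (c : ℝ) (n : ℕ) (T S : WeightedTree.{u}) : Prop :=
  ∃ cs : List ℝ, EditPath T S cs ∧ cs.length ≤ n ∧ ∀ a ∈ cs, a ≤ c

theorem Reaches.of_isIso {c : ℝ} {T S : WeightedTree.{u}} (h : IsIso T S) : Reaches c 0 T S :=
  ⟨[], .nil h, le_rfl, by simp⟩

theorem Reaches.cons {c d : ℝ} {n : ℕ} {T S R : WeightedTree.{u}} (h : Edit T S d) (hd : d ≤ c)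
    (h' : Reaches c n S R) : Reaches c (n + 1) T R := by
  obtain ⟨cs, hcs, hn, hc⟩ := h'
  refine ⟨d :: cs, .cons h hcs, by simpa using hn, ?_⟩
  simpa using ⟨hd, hc⟩

theorem Reaches.congr_left {c : ℝ} {n : ℕ} {T S R : WeightedTree.{u}} (h : IsIso T S)
    (h' : Reaches c n S R) : Reaches c n T R := by
  obtain ⟨cs, hcs, hn, hc⟩ := h'
  refine ⟨cs, ?_, hn, hc⟩
  cases hcs with
  | nil h1 => exact .nil (h.trans h1)
  | cons h1 hs => exact .cons (h1.congr h.symm (IsIso.refl _)) hs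

theorem Reaches.mono {c : ℝ} {n m : ℕ} {T S : WeightedTree.{u}} (h : Reaches c n T S)
    (hnm : n ≤ m) : Reaches c m T S := by
  obtain ⟨cs, hcs, hn, hc⟩ := h
  exact ⟨cs, hcs, hn.trans hnm, hc⟩

theorem Reaches.trans {c : ℝ} {n m : ℕ} {T S R : WeightedTree.{u}} (h : Reaches c n T S)
    (h' : Reaches c m S R) : Reaches c (n + m) T R := by
  obtain ⟨cs, hcs, hn, hc⟩ := h
  induction hcs generalizing n with
  | nil h => exact (h'.congr_left h).mono (by omega)
  | cons h hs ih =>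
    obtain ⟨n, rfl⟩ : ∃ k, n = k + 1 := ⟨n - 1, by simp at hn; omega⟩
    refine (Reaches.cons h (hc _ (by simp)) (ih (n := n) h' (by simpa using hn) fun a ha =>
      hc a (by simp [ha]))).mono (by omega)

theorem Reaches.symm {c : ℝ} {n : ℕ} {T S : WeightedTree.{u}} (h : Reaches c n T S) :
    Reaches c n S T := by
  obtain ⟨cs, hcs, hn, hc⟩ := h
  induction hcs generalizing n with
  | nil h => exact (Reaches.of_isIso h.symm).mono (Nat.zero_le n)
  | cons h hs ih =>
    obtain ⟨n, rfl⟩ : ∃ k, n = k + 1 := ⟨n - 1, by simp at hn; omega⟩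
    exact (ih (n := n) (by simpa using hn) fun a ha => hc a (by simp [ha])).trans
      (Reaches.cons h.symm (hc _ (by simp)) (Reaches.of_isIso (IsIso.refl _)))

end WeightedTree
end MergeTrees

namespace MergeTrees

/-! ### Deleting, ghosting and shrinking many edges -/

namespace RootedTree

/-- `ι` preserves and reflects the ancestor order. -/
def IsEmb {S T : RootedTree.{u}} (ι : S.V → T.V) : Prop :=
  ∀ a b, T.Le (ι a) (ι b) ↔ S.Le a b

variable {R S T : RootedTree.{u}} {ι : S.V → T.V}

theorem IsEmb.injective (h : IsEmb ι) : Function.Injective ι := fun a b hab =>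
  ((h a b).mp (hab ▸ Le.refl _)).antisymm ((h b a).mp (hab ▸ Le.refl _))

theorem IsEmb.comp {κ : R.V → S.V} (h : IsEmb ι) (h' : IsEmb κ) : IsEmb (ι ∘ κ) := fun a b =>
  (h _ _).trans (h' a b)

theorem IsEmb.map_root (h : IsEmb ι) (hr : T.root ∈ Set.range ι) : ι S.root = T.root := by
  obtain ⟨a, ha⟩ := hr
  have h1 : T.Le (ι a) (ι S.root) := (h _ _).mpr (le_root a)
  rw [ha] at h1
  exact eq_root_of_root_le h1

theorem IsEmb.map_parent (h : IsEmb ι) {a : S.V} (ha : ι a ≠ T.root)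
    (hp : T.parent (ι a) ∈ Set.range ι) : ι (S.parent a) = T.parent (ι a) := by
  obtain ⟨b, hb⟩ := hp
  rw [← hb]
  refine congrArg ι (parent_eq_of_forall_le ((h _ _).mp (hb ▸ le_parent _)) ?_ fun q hq hne => ?_)
  · rintro rfl
    exact parent_ne ha hb.symm
  · rw [← h, hb]
    exact parent_le_of_le_of_ne ((h _ _).mpr hq) (h.injective.ne hne)

theorem isEmb_removeVal (v : T.V) (hv : v ≠ T.root) : IsEmb (removeVal T v hv) :=
  removeVal_le_iff T v hv

theorem IsEmb.comp_removeVal {v : T.V} {hv : v ≠ T.root} {κ : R.V → (T.remove v hv).V}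
    (h : IsEmb κ) : IsEmb (removeVal T v hv ∘ κ) :=
  (isEmb_removeVal v hv).comp h

theorem range_removeVal_comp {v : T.V} {hv : v ≠ T.root} {α : Type*} {κ : α → (T.remove v hv).V}
    {Q : Set T.V} (hvQ : v ∉ Q) (h : Set.range κ = removeVal T v hv ⁻¹' Q) :
    Set.range (removeVal T v hv ∘ κ) = Q := by
  rw [Set.range_comp, h, Set.image_preimage_eq_inter_range, range_removeVal]
  exact Set.inter_eq_left.mpr fun x hx hxv => hvQ (hxv ▸ hx)

end RootedTree

namespace WeightedTree

open MergeTrees.RootedTree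

theorem removesVertex_removeVal {T : WeightedTree.{u}} (v : T.V) (hv : v ≠ T.root)
    (w : (T.toRootedTree.remove v hv).V → ℝ) (hw : ∀ u, u ≠ (T.toRootedTree.remove v hv).root →
      0 < w u) :
    RemovesVertex T ⟨T.toRootedTree.remove v hv, w, hw⟩ v (removeVal T.toRootedTree v hv) :=
  ⟨hv, removeVal_injective _ v hv, range_removeVal _ v hv, rfl, removeVal_parent _ v hv⟩

/-- Vertices whose edges have small weight can be deleted one after the other. Deletions do not
change the weights of the remaining edges, so the order does not matter. -/
theorem exists_deletion {c : ℝ} (T : WeightedTree.{u}) (Q : Set T.V) (hr : T.root ∈ Q)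
    (hQ : ∀ v, v ∉ Q → T.weight v ≤ c) :
    ∃ (S : WeightedTree.{u}) (ι : S.V → T.V), IsEmb ι ∧ Set.range ι = Q ∧
      (∀ a, a ≠ S.root → S.weight a = T.weight (ι a)) ∧
      ∃ n, Reaches c n T S ∧ n + Fintype.card S.V = Fintype.card T.V := by
  induction hN : Fintype.card T.V generalizing T with
  | zero => exact absurd hN (Fintype.card_pos_iff.mpr ⟨T.root⟩).ne'
  | succ N ih =>
    by_cases hall : ∀ v, v ∈ Q
    · exact ⟨T, id, fun _ _ => Iff.rfl, by ext x; simp [hall x], fun _ _ => rfl, 0,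
        .of_isIso (IsIso.refl T), by omega⟩
    push Not at hall
    obtain ⟨v, hv⟩ := hall
    have hvr : v ≠ T.root := fun h => hv (h ▸ hr)
    set val := removeVal T.toRootedTree v hvr with hval
    have hval0 : ∀ u, u ≠ (T.toRootedTree.remove v hvr).root → val u ≠ T.root :=
      fun u hu h => hu (removeVal_injective _ v hvr h)
    let R : WeightedTree.{u} :=
      ⟨T.toRootedTree.remove v hvr, fun u => T.weight (val u),
        fun u hu => T.weight_pos _ (hval0 u hu)⟩
    obtain ⟨S, ι, hι, hrange, hw, n, hn, hcard⟩ := ih R (val ⁻¹' Q) hr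
      (fun u hu => hQ (val u) hu)
      (Nat.succ_injective ((card_remove T.toRootedTree v hvr).trans hN))
    exact ⟨S, val ∘ ι, hι.comp_removeVal, range_removeVal_comp hv hrange, hw, n + 1,
      hn.cons (.delete ⟨val, removesVertex_removeVal v hvr _ _, fun _ _ => rfl⟩) (hQ v hv),
      by omega⟩

/-- The weights of `T` are the differences of the heights `H`. -/
def IsHeight (T : WeightedTree.{u}) (H : T.V → ℝ) : Prop :=
  ∀ u, u ≠ T.root → T.weight u = H (T.parent u) - H u

theorem IsHeight.lt_parent {T : WeightedTree.{u}} {H : T.V → ℝ} (hH : IsHeight T H) {u : T.V}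
    (hu : u ≠ T.root) : H u < H (T.parent u) := by
  have := T.weight_pos u hu
  rw [hH u hu] at this
  linarith

theorem IsHeight.mono {T : WeightedTree.{u}} {H : T.V → ℝ} (hH : IsHeight T H) {u v : T.V}
    (h : T.Le u v) : H u ≤ H v := by
  obtain ⟨n, rfl⟩ := h
  induction n generalizing u with
  | zero => exact le_rfl
  | succ n ih =>
    rw [Function.iterate_succ_apply]
    refine le_trans ?_ ih
    by_cases hu : u = T.root
    · rw [hu, T.parent_root]
    · exact (hH.lt_parent hu).le

theorem IsHeight.lt {T : WeightedTree.{u}} {H : T.V → ℝ} (hH : IsHeight T H) {u v : T.V}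
    (h : T.Le u v) (hne : u ≠ v) : H u < H v :=
  (hH.lt_parent fun hu => hne (by
    rw [hu] at h ⊢
    exact (eq_root_of_root_le h).symm)).trans_le (hH.mono (parent_le_of_le_of_ne h hne))

/-- Vertices with exactly one child, that is, those whose proper descendants have a greatest
element, can be ghosted one after the other. The heights of the remaining vertices do not change. -/
theorem exists_ghosting {c : ℝ} (hc : 0 ≤ c) (T : WeightedTree.{u}) (H : T.V → ℝ)
    (hH : IsHeight T H) (Q : Set T.V) (hr : T.root ∈ Q)
    (hQ : ∀ v, v ∉ Q → ∃ d, T.Le d v ∧ d ≠ v ∧ ∀ u, T.Le u v → u ≠ v → T.Le u d) :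
    ∃ (S : WeightedTree.{u}) (ι : S.V → T.V), IsEmb ι ∧ Set.range ι = Q ∧ IsHeight S (H ∘ ι) ∧
      ∃ n, Reaches c n T S ∧ n + Fintype.card S.V = Fintype.card T.V := by
  classical
  induction hN : Fintype.card T.V generalizing T with
  | zero => exact absurd hN (Fintype.card_pos_iff.mpr ⟨T.root⟩).ne'
  | succ N ih =>
    by_cases hall : ∀ v, v ∈ Q
    · exact ⟨T, id, fun _ _ => Iff.rfl, by ext x; simp [hall x], hH, 0,
        .of_isIso (IsIso.refl T), by omega⟩
    push Not at hall
    obtain ⟨v, hv⟩ := hall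
    have hvr : v ≠ T.root := fun h => hv (h ▸ hr)
    obtain ⟨d, hdv, hdne, hd⟩ := hQ v hv
    have hchild : ∀ u, (u ≠ T.root ∧ T.parent u = v) ↔ u = d := by
      have hu : ∀ u, u ≠ T.root → T.parent u = v → u = d := by
        intro u hur huv
        by_contra hne
        have h1 : T.Le u d := hd u (huv ▸ le_parent u) fun h => parent_ne hur (by rw [huv, h])
        have h2 := parent_le_of_le_of_ne h1 hne
        rw [huv] at h2
        exact hdne (hdv.antisymm h2)
      refine fun u => ⟨fun h => hu u h.1 h.2, ?_⟩
      rintro rfl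
      obtain ⟨e, her, hev, -⟩ := exists_child hdv hdne
      rw [← hu e her hev]
      exact ⟨her, hev⟩
    set val := removeVal T.toRootedTree v hvr with hval
    have hinj : Function.Injective val := removeVal_injective _ v hvr
    have hval0 : ∀ u, u ≠ (T.toRootedTree.remove v hvr).root → val u ≠ T.root :=
      fun u hu h => hu (hinj h)
    have hpar := removeVal_parent T.toRootedTree v hvr
    have hsurj : ∀ u, u ≠ v → ∃ a, val a = u := fun u hu => ⟨⟨u, hu⟩, rfl⟩
    have hvalv : ∀ a, val a ≠ v := fun a => a.2
    have hle := removeVal_le_iff T.toRootedTree v hvr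
    rw [← hval] at hpar hle
    let R : WeightedTree.{u} :=
      ⟨T.toRootedTree.remove v hvr,
        fun u => H (val ((T.toRootedTree.remove v hvr).parent u)) - H (val u), fun u hu => by
          rw [hpar]
          have h1 := hH.lt_parent (hval0 u hu)
          split_ifs with h
          · rw [h] at h1
            linarith [hH.lt_parent hvr]
          · linarith⟩
    have hgho : IsGhosting T R v := by
      refine ⟨d, val, hchild, removesVertex_removeVal v hvr _ _, fun u hu => ?_⟩
      change H (val ((T.toRootedTree.remove v hvr).parent u)) - H (val u) =
        if val u = d then T.weight d + T.weight v else T.weight (val u)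
      rw [hpar]
      by_cases h : val u = d
      · have hdr := (hchild d).mpr rfl
        rw [if_pos h, h, if_pos hdr.2, hH d hdr.1, hH v hvr, hdr.2]
        ring
      · rw [if_neg h, if_neg fun h' => h ((hchild _).mp ⟨hval0 u hu, h'⟩), hH _ (hval0 u hu)]
    have hR : ∀ u, u ∉ val ⁻¹' Q →
        ∃ d, R.Le d u ∧ d ≠ u ∧ ∀ a, R.Le a u → a ≠ u → R.Le a d := by
      intro u hu
      obtain ⟨e, heu, hne, he⟩ := hQ (val u) hu
      by_cases hev : e = v
      -- If the greatest proper descendant of `u` is `v`, its role is taken over by that of `v`.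
      · obtain ⟨d, rfl⟩ := hsurj d hdne
        rw [hev] at heu he
        refine ⟨d, (hle _ _).mp (hdv.trans heu), ?_, fun a ha hau => ?_⟩
        · rintro rfl
          exact hdne (hdv.antisymm heu)
        · exact (hle _ _).mp (hd _ (he _ ((hle _ _).mpr ha) (hinj.ne hau)) (hvalv a))
      · obtain ⟨e, rfl⟩ := hsurj e hev
        exact ⟨e, (hle _ _).mp heu, fun h => hne (congrArg val h),
          fun a ha hau => (hle _ _).mp (he _ ((hle _ _).mpr ha) (hinj.ne hau))⟩
    obtain ⟨S, ι, hι, hrange, hw, n, hn, hcard⟩ := ih R (fun u => H (val u)) (fun _ _ => rfl)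
      (val ⁻¹' Q) hr hR (Nat.succ_injective ((card_remove T.toRootedTree v hvr).trans hN))
    exact ⟨S, val ∘ ι, hι.comp_removeVal, range_removeVal_comp hv hrange, hw, n + 1,
      hn.cons (.ghost hgho) hc, by omega⟩

/-- If two weighted trees differ only in their weights, shrinkings turn one into the other. -/
theorem reaches_of_equiv {c : ℝ} {T S : WeightedTree.{u}} (e : T.V ≃ S.V)
    (hr : e T.root = S.root) (hp : ∀ u, e (T.parent u) = S.parent (e u))
    (hw : ∀ u, u ≠ T.root → |S.weight (e u) - T.weight u| ≤ c) :
    Reaches c (Fintype.card T.V) T S := by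
  classical
  suffices h : ∀ (n : ℕ) (T : WeightedTree.{u}) (e : T.V ≃ S.V), e T.root = S.root →
      (∀ u, e (T.parent u) = S.parent (e u)) →
      (∀ u, u ≠ T.root → |S.weight (e u) - T.weight u| ≤ c) →
      (Finset.univ.filter fun u => u ≠ T.root ∧ S.weight (e u) ≠ T.weight u).card = n →
      Reaches c n T S from
    (h _ T e hr hp hw rfl).mono (Finset.card_le_univ _)
  clear hr hp hw e T
  intro n
  induction n with
  | zero =>
    intro T e hr hp hw hn
    refine .of_isIso ⟨e, hr, hp, fun u hu => ?_⟩
    by_contra hne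
    have h1 := Finset.card_eq_zero.mp hn
    exact Finset.notMem_empty u (h1 ▸ Finset.mem_filter.mpr ⟨Finset.mem_univ _, hu, hne⟩)
  | succ n ih =>
    intro T e hr hp hw hn
    obtain ⟨v, hv⟩ := Finset.card_pos.mp (lt_of_lt_of_eq (Nat.succ_pos n) hn.symm)
    obtain ⟨-, hvr, hvne⟩ := Finset.mem_filter.mp hv
    let R : WeightedTree.{u} :=
      { toRootedTree := T.toRootedTree
        weight := Function.update T.weight v (S.weight (e v))
        weight_pos := fun u hu => by
          by_cases h : u = v
          · subst h
            rw [Function.update_self]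
            exact S.weight_pos _ fun h => hvr (e.injective (h.trans hr.symm))
          · rw [Function.update_of_ne h]
            exact T.weight_pos u hu }
    have hshr : IsShrinking T R v (S.weight (e v)) :=
      ⟨hvr, Equiv.refl _, rfl, fun _ => rfl, fun u _ huv => Function.update_of_ne huv _ _,
        Function.update_self v (S.weight (e v)) T.weight⟩
    refine Reaches.cons (.shrink hshr) (hw v hvr) (ih R e hr hp (fun u hu => ?_) ?_)
    · change |S.weight (e u) - Function.update T.weight v (S.weight (e v)) u| ≤ c
      by_cases h : u = v
      · rw [h, Function.update_self, sub_self, abs_zero]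
        exact (abs_nonneg _).trans (hw u hu)
      · rw [Function.update_of_ne h]
        exact hw u hu
    · have hers : (Finset.univ.filter fun u : R.V => u ≠ R.root ∧ S.weight (e u) ≠ R.weight u) =
          (Finset.univ.filter fun u => u ≠ T.root ∧ S.weight (e u) ≠ T.weight u).erase v := by
        ext u
        simp only [Finset.mem_filter, Finset.mem_univ, true_and, Finset.mem_erase]
        by_cases h : u = v
        · simp [R, h]
        · simp [R, h]
      rw [hers, Finset.card_erase_of_mem hv, hn]
      rfl

end WeightedTree
end MergeTrees

namespace MergeTrees

/-! ### Trees with marked vertices and their clusters -/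

namespace WeightedTree

open MergeTrees.RootedTree

/-- A height function on a weighted tree whose differences are the weights, together with a family
of marked vertices. -/
structure Marking (T : WeightedTree.{u}) (I : Type*) where
  height : T.V → ℝ
  isHeight : IsHeight T height
  mark : I → T.V

namespace Marking

variable {T T' : WeightedTree.{u}} {I : Type*} (A : Marking T I) (A' : Marking T' I)

/-- The height at which the marked vertices `i` and `j` come together, that is, the least height of
a common ancestor. -/
noncomputable def join (i j : I) : ℝ :=
  sInf (A.height '' {v | T.Le (A.mark i) v ∧ T.Le (A.mark j) v})

theorem isLeast_join (i j : I) :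
    IsLeast (A.height '' {v | T.Le (A.mark i) v ∧ T.Le (A.mark j) v}) (A.join i j) := by
  have hfin : (A.height '' {v | T.Le (A.mark i) v ∧ T.Le (A.mark j) v}).Finite := Set.toFinite _
  exact ⟨Set.Nonempty.csInf_mem ⟨_, T.root, ⟨le_root _, le_root _⟩, rfl⟩ hfin,
    fun _ h => csInf_le hfin.bddBelow h⟩

/-- The indices of the marked vertices below `v`. -/
def cluster (v : T.V) : Set I := {i | T.Le (A.mark i) v}

/-- `v` is the lowest vertex whose cluster is that of `v`, and this cluster is not empty. -/
def IsEssential (v : T.V) : Prop :=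
  (A.cluster v).Nonempty ∧ ∀ u, T.Le u v → A.cluster u = A.cluster v → u = v

/-- The tree spanned by the marked vertices has as its vertices the root and the essential
vertices. -/
def span : Set T.V := {v | v = T.root ∨ A.IsEssential v}

/-- `p` is the father of `v` in the tree spanned by the marked vertices. -/
def IsNext (v p : T.V) : Prop :=
  p ∈ A.span ∧ T.Le v p ∧ v ≠ p ∧ ∀ q ∈ A.span, T.Le v q → v ≠ q → T.Le p q

variable {A A'}

theorem cluster_mono {u v : T.V} (h : T.Le u v) : A.cluster u ⊆ A.cluster v := fun _ hi =>
  Le.trans hi h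

theorem total_of_mem {u v : T.V} {i : I} (hu : i ∈ A.cluster u) (hv : i ∈ A.cluster v) :
    T.Le u v ∨ T.Le v u := Le.total hu hv

theorem IsEssential.le_of_subset {v w : T.V} (hv : A.IsEssential v)
    (h : A.cluster v ⊆ A.cluster w) : T.Le v w := by
  obtain ⟨i, hi⟩ := hv.1
  rcases total_of_mem hi (h hi) with hle | hle
  · exact hle
  · rw [hv.2 w hle ((cluster_mono hle).antisymm h)]
    exact Le.refl _

theorem IsEssential.eq_of_cluster_eq {v w : T.V} (hv : A.IsEssential v) (hw : A.IsEssential w)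
    (h : A.cluster v = A.cluster w) : v = w :=
  (hv.le_of_subset h.subset).antisymm (hw.le_of_subset h.symm.subset)

theorem exists_isEssential {w : T.V} (hw : (A.cluster w).Nonempty) :
    ∃ v, T.Le v w ∧ A.IsEssential v ∧ A.cluster v = A.cluster w := by
  obtain ⟨v, ⟨hvw, hv⟩, hmin⟩ := Set.exists_min_image {v | T.Le v w ∧ A.cluster v = A.cluster w}
    A.height (Set.toFinite _) ⟨w, Le.refl w, rfl⟩
  refine ⟨v, hvw, ⟨hv ▸ hw, fun u hu h => ?_⟩, hv⟩
  by_contra hne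
  exact absurd (hmin u ⟨hu.trans hvw, h.trans hv⟩) (not_le.mpr (A.isHeight.lt hu hne))

theorem join_le {v : T.V} {i j : I} (hi : i ∈ A.cluster v) (hj : j ∈ A.cluster v) :
    A.join i j ≤ A.height v :=
  (A.isLeast_join i j).2 ⟨v, ⟨hi, hj⟩, rfl⟩

theorem exists_join (A : Marking T I) (i j : I) :
    ∃ v, i ∈ A.cluster v ∧ j ∈ A.cluster v ∧ A.height v = A.join i j := by
  obtain ⟨v, hv, h⟩ := (A.isLeast_join i j).1
  exact ⟨v, hv.1, hv.2, h⟩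

/-- The height of an essential vertex is the diameter of its cluster with respect to `join`. -/
theorem IsEssential.exists_height_eq_join {v : T.V} (hv : A.IsEssential v) :
    ∃ i ∈ A.cluster v, ∃ j ∈ A.cluster v, A.join i j = A.height v := by
  obtain ⟨i, hi⟩ := hv.1
  suffices h : ∃ j ∈ A.cluster v, ∀ w, i ∈ A.cluster w → j ∈ A.cluster w → T.Le w v → w = v by
    obtain ⟨j, hj, h⟩ := h
    refine ⟨i, hi, j, hj, (join_le hi hj).antisymm ?_⟩
    obtain ⟨w, hiw, hjw, hw⟩ := A.exists_join i j
    rw [← hw]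
    rcases total_of_mem hi hiw with hle | hle
    · exact A.isHeight.mono hle
    · rw [h w hiw hjw hle]
  by_cases hiv : A.mark i = v
  · exact ⟨i, hi, fun w hiw _ hwv => hwv.antisymm (hiv ▸ hiw)⟩
  obtain ⟨u, hur, huv, hiu⟩ := exists_child hi hiv
  have hule : T.Le u v := huv ▸ le_parent u
  obtain ⟨j, hj, hju⟩ : ∃ j ∈ A.cluster v, j ∉ A.cluster u := by
    by_contra! hcon
    have h := hv.2 u hule ((cluster_mono hule).antisymm hcon)
    exact parent_ne hur (huv.trans h.symm)
  refine ⟨j, hj, fun w hiw hjw hwv => ?_⟩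
  rcases total_of_mem hiu hiw with hle | hle
  · refine hwv.antisymm ?_
    rw [← huv]
    refine parent_le_of_le_of_ne hle ?_
    rintro rfl
    exact hju hjw
  · exact absurd (cluster_mono hle hjw) hju

/-- The father of `v` in the spanned tree is not higher than the joins of the cluster of `v` with
the other marked vertices. -/
theorem IsNext.height_le_join {v p : T.V} (h : A.IsNext v p) {i j : I} (hi : i ∈ A.cluster v)
    (hj : j ∉ A.cluster v) : A.height p ≤ A.join i j := by
  obtain ⟨z, hiz, hjz, hz⟩ := A.exists_join i j
  obtain ⟨y, hyz, hy, hyc⟩ := exists_isEssential ⟨i, hiz⟩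
  have hjy : j ∈ A.cluster y := by rwa [hyc]
  rw [← hz]
  refine A.isHeight.mono (Le.trans ?_ hyz)
  rcases total_of_mem hi (v := y) (by rwa [hyc]) with hle | hle
  · refine h.2.2.2 y (Or.inr hy) hle ?_
    rintro rfl
    exact hj hjy
  · exact absurd (cluster_mono hle hjy) hj

/-- The bound of `IsNext.height_le_join` is attained. -/
theorem IsNext.exists_join_le {v p : T.V} (h : A.IsNext v p) {i : I} (hi : i ∈ A.cluster v)
    (hv : A.cluster v ≠ Set.univ) : ∃ j ∉ A.cluster v, A.join i j ≤ A.height p := by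
  have hip : i ∈ A.cluster p := cluster_mono h.2.1 hi
  suffices hj : ∃ j ∈ A.cluster p, j ∉ A.cluster v by
    obtain ⟨j, hjp, hj⟩ := hj
    exact ⟨j, hj, join_le hip hjp⟩
  rcases h.1 with rfl | hp
  · obtain ⟨j, hj⟩ := (Set.ne_univ_iff_exists_notMem _).mp hv
    exact ⟨j, le_root _, hj⟩
  · by_contra! hcon
    exact h.2.2.1 (hp.2 v h.2.1 ((cluster_mono h.2.1).antisymm hcon))

theorem IsNext.eq_root {v p : T.V} (h : A.IsNext v p) (hv : A.cluster v = Set.univ) :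
    p = T.root := by
  rcases h.1 with rfl | hp
  · rfl
  · refine absurd (hp.2 v h.2.1 ((cluster_mono h.2.1).antisymm ?_)) h.2.2.1
    rw [hv]
    exact Set.subset_univ _

/-! ### Comparing two markings with nearby join heights -/

theorem height_le_of_cluster_eq {ε : ℝ} (hε : ∀ i j, |A.join i j - A'.join i j| ≤ ε) {v : T.V}
    {v' : T'.V} (hv : A.IsEssential v) (hc : A.cluster v = A'.cluster v') :
    A.height v ≤ A'.height v' + ε := by
  obtain ⟨i, hi, j, hj, h⟩ := hv.exists_height_eq_join
  have h1 := (abs_le.mp (hε i j)).2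
  have h2 := join_le (A := A') (hc ▸ hi) (hc ▸ hj)
  linarith

theorem height_next_le_of_cluster_eq {ε : ℝ} (hε : ∀ i j, |A.join i j - A'.join i j| ≤ ε)
    (hε0 : 0 ≤ ε) (hroot : A.height T.root = A'.height T'.root) {v p : T.V} {v' p' : T'.V}
    (hv : A.IsEssential v) (hp : A.IsNext v p) (hp' : A'.IsNext v' p')
    (hc : A.cluster v = A'.cluster v') : A.height p ≤ A'.height p' + ε := by
  obtain ⟨i, hi⟩ := hv.1
  by_cases huniv : A.cluster v = Set.univ
  · rw [hp.eq_root huniv, hp'.eq_root (hc ▸ huniv), hroot]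
    linarith
  · obtain ⟨j, hj, h⟩ := hp'.exists_join_le (hc ▸ hi) (hc ▸ huniv)
    have h1 := (abs_le.mp (hε i j)).2
    have h2 := hp.height_le_join hi (hc ▸ hj)
    linarith

/-- A long edge of one spanned tree cuts off a cluster that also occurs in the other one. -/
theorem exists_cluster_eq [Finite I] {ε : ℝ} (hε : ∀ i j, |A.join i j - A'.join i j| ≤ ε)
    (hε0 : 0 ≤ ε) (hroot : A.height T.root = A'.height T'.root) {v p : T.V}
    (hv : A.IsEssential v) (hp : A.IsNext v p) (hlong : 2 * ε < A.height p - A.height v) :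
    ∃ v', A'.IsEssential v' ∧ v' ≠ T'.root ∧ A'.cluster v' = A.cluster v := by
  obtain ⟨i, hi⟩ := hv.1
  -- The lowest vertex `w` of the second tree above all marked vertices of the cluster of `v`.
  obtain ⟨j, hj, hmax⟩ := Set.exists_max_image (A.cluster v) (A'.join i) (Set.toFinite _) ⟨i, hi⟩
  obtain ⟨w, hiw, hjw, hw⟩ := A'.exists_join i j
  have hsub : A.cluster v ⊆ A'.cluster w := by
    intro k hk
    obtain ⟨z, hiz, hkz, hz⟩ := A'.exists_join i k
    rcases total_of_mem hiz hiw with hle | hle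
    · exact cluster_mono hle hkz
    · by_cases hzw : w = z
      · rwa [hzw]
      · have h1 := A'.isHeight.lt hle hzw
        have h2 := hmax k hk
        linarith
  have hwv : A'.height w ≤ A.height v + ε := by
    have h1 := (abs_le.mp (hε i j)).1
    have h2 := join_le hi hj
    linarith
  have hwc : A'.cluster w = A.cluster v := by
    refine Set.Subset.antisymm (fun k hk => ?_) hsub
    by_contra hkv
    have h1 := (abs_le.mp (hε i k)).2
    have h2 := hp.height_le_join hi hkv
    have h3 := join_le hiw hk
    linarith
  obtain ⟨v', hv'w, hv', hc⟩ := exists_isEssential ⟨i, hiw⟩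
  refine ⟨v', hv', ?_, hc.trans hwc⟩
  rintro rfl
  have h1 := A'.isHeight.mono hv'w
  have h2 := A.isHeight.mono (le_root p)
  linarith

/-! ### Reduction to the spanned tree -/

/-- Deleting the branches without marked vertices, ghosting the vertices that are not essential and
deleting the vertices of the spanned tree outside `M`, whose edges are short, leaves a tree with
vertex set `M`. The weights are still those of the spanned tree, not of the tree on `M`. -/
theorem exists_reduction {c : ℝ} (hc : 0 ≤ c) (A : Marking T I)
    (hempty : ∀ v, v ≠ T.root → A.cluster v = ∅ → T.weight v ≤ c) (M : Set T.V)
    (hMs : M ⊆ A.span) (hMr : T.root ∈ M)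
    (hM : ∀ v ∈ A.span, v ∉ M → ∀ p, A.IsNext v p → A.height p - A.height v ≤ c) :
    ∃ (S : WeightedTree.{u}) (ι : S.V → T.V), IsEmb ι ∧ Set.range ι = M ∧
      (∀ a, a ≠ S.root → ∃ p, A.IsNext (ι a) p ∧ S.weight a = A.height p - A.height (ι a)) ∧
      ∃ n, Reaches c n T S ∧ n + Fintype.card S.V = Fintype.card T.V := by
  obtain ⟨S, ι, hι, hrange, hw, n, hn, hcard⟩ := exists_deletion (c := c) T
    {v | v = T.root ∨ (A.cluster v).Nonempty} (Or.inl rfl) fun v hv => by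
      simp only [Set.mem_ofPred_eq, not_or, Set.not_nonempty_iff_eq_empty] at hv
      exact hempty v hv.1 hv.2
  have hιr : ι S.root = T.root := hι.map_root (hrange ▸ Or.inl rfl)
  have hιne : ∀ a, a ≠ S.root → ι a ≠ T.root := fun a ha h => ha (hι.injective (h.trans hιr.symm))
  have hne : ∀ a, a ≠ S.root → (A.cluster (ι a)).Nonempty := fun a ha =>
    (hrange.subset ⟨a, rfl⟩).resolve_left (hιne a ha)
  have hH : IsHeight S (A.height ∘ ι) := by
    intro a ha
    have hpar : ι (S.parent a) = T.parent (ι a) := by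
      refine hι.map_parent (hιne a ha) ?_
      rw [hrange]
      exact Or.inr ((hne a ha).mono (cluster_mono (le_parent _)))
    rw [hw a ha, A.isHeight _ (hιne a ha), Function.comp_apply, hpar]
    rfl
  obtain ⟨R, κ, hκ, hrange', hwR, m, hm, hcard'⟩ := exists_ghosting hc S _ hH (ι ⁻¹' A.span)
    (Or.inl hιr) fun v hv => by
      have hvr : v ≠ S.root := fun h => hv (Or.inl (h ▸ hιr))
      have hess : ¬ A.IsEssential (ι v) := fun h => hv (Or.inr h)
      simp only [IsEssential, hne v hvr, true_and, not_forall] at hess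
      obtain ⟨u, huv, hu, hune⟩ := hess
      -- The child `d` of `v` above `u` has the same cluster as `v`, so no other child of `v` is
      -- above a marked vertex.
      obtain ⟨d, hdr, hdv, hud⟩ := exists_child huv hune
      have hdle : T.Le d (ι v) := hdv ▸ le_parent d
      have hd : A.cluster d = A.cluster (ι v) :=
        (cluster_mono hdle).antisymm (hu ▸ cluster_mono hud)
      obtain ⟨d, rfl⟩ : d ∈ Set.range ι := hrange ▸ Or.inr (hd ▸ hne v hvr)
      refine ⟨d, (hι _ _).mp hdle, ?_, fun a ha hav => ?_⟩
      · rintro rfl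
        exact parent_ne hdr hdv
      · have har : a ≠ S.root := fun h => by
          rw [h] at ha hav
          exact hav (eq_root_of_root_le ha).symm
        obtain ⟨i, hi⟩ := hne a har
        rw [← hι] at ha ⊢
        rcases total_of_mem hi (v := ι d) (hd ▸ cluster_mono ha hi) with hle | hle
        · exact hle
        · by_cases hda : ι d = ι a
          · exact hda ▸ hle
          · have h1 := parent_le_of_le_of_ne hle hda
            rw [hdv] at h1
            exact absurd (hι.injective (ha.antisymm h1)) hav
  have hικ := hι.comp hκ
  have hrange2 : Set.range (ι ∘ κ) = A.span := by
    rw [Set.range_comp, hrange', Set.image_preimage_eq_inter_range, hrange]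
    exact Set.inter_eq_left.mpr fun v hv => hv.imp_right fun h => h.1
  have hnext : ∀ a, a ≠ R.root → A.IsNext (ι (κ a)) (ι (κ (R.parent a))) := by
    intro a ha
    refine ⟨hrange2.subset ⟨_, rfl⟩, (hικ _ _).mpr (le_parent a),
      hικ.injective.ne (parent_ne ha).symm, fun q hq haq hne => ?_⟩
    obtain ⟨b, rfl⟩ := hrange2.superset hq
    refine (hικ _ _).mpr (parent_le_of_le_of_ne ((hικ _ _).mp haq) ?_)
    rintro rfl
    exact hne rfl
  have hκr : ι (κ R.root) = T.root := hικ.map_root (hrange2 ▸ Or.inl rfl)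
  obtain ⟨Q, μ, hμ, hrange3, hwQ, k, hk, hcard3⟩ := exists_deletion (c := c) R
    (ι ∘ κ ⁻¹' M) (by rw [Set.mem_preimage, Function.comp_apply, hκr]; exact hMr) fun v hv => by
      have hvr : v ≠ R.root := fun h => hv (by
        rw [h, Set.mem_preimage, Function.comp_apply, hκr]; exact hMr)
      rw [hwR v hvr]
      exact hM _ (hrange2.subset ⟨v, rfl⟩) hv _ (hnext v hvr)
  refine ⟨Q, (ι ∘ κ) ∘ μ, hικ.comp hμ, ?_, fun a ha => ?_, n + m + k, (hn.trans hm).trans hk,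
    by omega⟩
  · rw [Set.range_comp, hrange3, Set.image_preimage_eq_inter_range, hrange2]
    exact Set.inter_eq_left.mpr hMs
  · have hr : μ Q.root = R.root := hμ.map_root (hrange3 ▸ (by
      rw [Set.mem_preimage, Function.comp_apply, hκr]; exact hMr))
    have har : μ a ≠ R.root := fun h => ha (hμ.injective (h.trans hr.symm))
    exact ⟨_, hnext _ har, (hwQ a ha).trans (hwR _ har)⟩

end Marking
end WeightedTree
end MergeTrees

namespace MergeTrees
namespace WeightedTree

open MergeTrees.RootedTree

namespace Marking

variable {T T' : WeightedTree.{u}} {I : Type*} {A : Marking T I} {A' : Marking T' I}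

/-! ### Edit paths between trees with nearby join heights -/

/-- The root serves as a common ancestor in both trees, so only common ancestors other than the root
have to be transferred. -/
theorem join_le_join_add {ε : ℝ} (hε0 : 0 ≤ ε) (hroot : A.height T.root = A'.height T'.root)
    {i j : I} (h : ∀ z, z ≠ T.root → i ∈ A.cluster z → j ∈ A.cluster z →
      ∃ z', i ∈ A'.cluster z' ∧ j ∈ A'.cluster z' ∧ A'.height z' ≤ A.height z + ε) :
    A'.join i j ≤ A.join i j + ε := by
  obtain ⟨z, hi, hj, hz⟩ := A.exists_join i j
  rw [← hz]
  by_cases hzr : z = T.root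
  · have h1 := join_le (A := A') (v := T'.root) (i := i) (j := j) (le_root _) (le_root _)
    rw [hzr]
    linarith
  · obtain ⟨z', hi', hj', hz'⟩ := h z hzr hi hj
    exact (join_le hi' hj').trans hz'

/-- The root and the essential vertices whose clusters also occur in the other tree. -/
def common (A : Marking T I) (A' : Marking T' I) : Set T.V :=
  {v | v = T.root ∨ (A.IsEssential v ∧
    ∃ v', A'.IsEssential v' ∧ v' ≠ T'.root ∧ A'.cluster v' = A.cluster v)}

/-- Vertices of the two reduced trees correspond if they have the same cluster. -/
theorem exists_corresponding {S S' : RootedTree.{u}} {ι : S.V → T.V} {ι' : S'.V → T'.V}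
    (hι : IsEmb ι) (hrange : Set.range ι = common A A') (hι' : IsEmb ι')
    (hrange' : Set.range ι' = common A' A) (a : S.V) :
    ∃ a', (a = S.root ↔ a' = S'.root) ∧ (a ≠ S.root → A.cluster (ι a) = A'.cluster (ι' a')) := by
  by_cases ha : a = S.root
  · exact ⟨S'.root, by simp [ha], fun h => absurd ha h⟩
  have hιr : ι S.root = T.root := hι.map_root (hrange ▸ Or.inl rfl)
  have hιr' : ι' S'.root = T'.root := hι'.map_root (hrange' ▸ Or.inl rfl)
  have hne : ι a ≠ T.root := fun h => ha (hι.injective (h.trans hιr.symm))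
  obtain ⟨hess, v', hv', hvr', hc⟩ := (hrange.subset ⟨a, rfl⟩).resolve_left hne
  obtain ⟨a', rfl⟩ : v' ∈ Set.range ι' := hrange' ▸ Or.inr ⟨hv', _, hess, hne, hc.symm⟩
  refine ⟨a', iff_of_false ha ?_, fun _ => hc.symm⟩
  rintro rfl
  exact hvr' hιr'

theorem isEssential_of_range {S : RootedTree.{u}} {ι : S.V → T.V} (hι : IsEmb ι)
    (hrange : Set.range ι = common A A') {a : S.V} (ha : a ≠ S.root) : A.IsEssential (ι a) := by
  have hιr : ι S.root = T.root := hι.map_root (hrange ▸ Or.inl rfl)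
  exact ((hrange.subset ⟨a, rfl⟩).resolve_left
    fun h => ha (hι.injective (h.trans hιr.symm))).1

/-- Reducing both trees to the common clusters gives the same tree up to its weights: on essential
vertices the ancestor order is the inclusion of clusters. -/
theorem exists_equiv {S S' : RootedTree.{u}} {ι : S.V → T.V} {ι' : S'.V → T'.V}
    (hι : IsEmb ι) (hrange : Set.range ι = common A A') (hι' : IsEmb ι')
    (hrange' : Set.range ι' = common A' A) :
    ∃ e : S.V ≃ S'.V, e S.root = S'.root ∧ (∀ a, e (S.parent a) = S'.parent (e a)) ∧
      ∀ a, a ≠ S.root → A.cluster (ι a) = A'.cluster (ι' (e a)) := by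
  choose F hF hFc using exists_corresponding hι hrange hι' hrange'
  choose G hG hGc using exists_corresponding hι' hrange' hι hrange
  have hess := fun a ha => isEssential_of_range (A := A) (a := a) hι hrange ha
  have hess' := fun a ha => isEssential_of_range (A := A') (a := a) hι' hrange' ha
  have hGF : ∀ a, G (F a) = a := by
    intro a
    by_cases ha : a = S.root
    · rw [ha]
      exact (hG _).mp ((hF _).mp rfl)
    · have h1 : F a ≠ S'.root := fun h => ha ((hF a).mpr h)
      have h2 : G (F a) ≠ S.root := fun h => h1 ((hG _).mpr h)
      exact hι.injective ((hess _ h2).eq_of_cluster_eq (hess _ ha)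
        ((hGc _ h1).symm.trans (hFc a ha).symm))
  have hFG : ∀ a, F (G a) = a := by
    intro a
    by_cases ha : a = S'.root
    · rw [ha]
      exact (hF _).mp ((hG _).mp rfl)
    · have h1 : G a ≠ S.root := fun h => ha ((hG a).mpr h)
      have h2 : F (G a) ≠ S'.root := fun h => h1 ((hF _).mpr h)
      exact hι'.injective ((hess' _ h2).eq_of_cluster_eq (hess' _ ha)
        ((hFc _ h1).symm.trans (hGc a ha).symm))
  let e : S.V ≃ S'.V := ⟨F, G, hGF, hFG⟩
  have hle : ∀ a b, S'.Le (e a) (e b) ↔ S.Le a b := by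
    intro a b
    change S'.Le (F a) (F b) ↔ _
    by_cases hb : b = S.root
    · rw [(hF b).mp hb, hb]
      exact iff_of_true (le_root _) (le_root _)
    have hb' : F b ≠ S'.root := fun h => hb ((hF b).mpr h)
    by_cases ha : a = S.root
    · rw [(hF a).mp ha, ha]
      exact iff_of_false (fun h => hb' (eq_root_of_root_le h)) fun h => hb (eq_root_of_root_le h)
    have ha' : F a ≠ S'.root := fun h => ha ((hF a).mpr h)
    rw [← hι, ← hι']
    constructor
    · intro h
      refine (hess a ha).le_of_subset ?_
      rw [hFc a ha, hFc b hb]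
      exact cluster_mono h
    · intro h
      refine (hess' _ ha').le_of_subset ?_
      rw [← hFc a ha, ← hFc b hb]
      exact cluster_mono h
  obtain ⟨h1, h2⟩ := map_root_and_parent e hle
  exact ⟨e, h1, h2, hFc⟩

/-- Both trees are reduced to the vertices whose clusters occur in both of them. The reduced trees
differ only in their weights, which are differences of heights that agree up to `ε`. For the number
of edits, each one is charged to the vertex that it removes or inserts, and a shrinking to the
vertex of the first tree whose edge it changes. -/
theorem reaches [Finite I] {ε : ℝ} (hε : ∀ i j, |A.join i j - A'.join i j| ≤ ε) (hε0 : 0 ≤ ε)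
    (hroot : A.height T.root = A'.height T'.root)
    (hempty : ∀ v, v ≠ T.root → A.cluster v = ∅ → T.weight v ≤ 2 * ε)
    (hempty' : ∀ v, v ≠ T'.root → A'.cluster v = ∅ → T'.weight v ≤ 2 * ε) :
    Reaches (2 * ε) (Fintype.card T.V + Fintype.card T'.V) T T' := by
  have hε' : ∀ i j, |A'.join i j - A.join i j| ≤ ε := fun i j =>
    (abs_sub_comm _ _).trans_le (hε i j)
  obtain ⟨S, ι, hι, hrange, hw, n, hn, hcard⟩ := exists_reduction (by linarith) A hempty
    (common A A') (fun v hv => hv.imp_right fun h => h.1) (Or.inl rfl) fun v hv hvM p hp => by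
      by_contra! hlong
      have hess : A.IsEssential v := hv.resolve_left fun h => hvM (Or.inl h)
      exact hvM (Or.inr ⟨hess, exists_cluster_eq hε hε0 hroot hess hp hlong⟩)
  obtain ⟨S', ι', hι', hrange', hw', n', hn', hcard'⟩ := exists_reduction (by linarith) A' hempty'
    (common A' A) (fun v hv => hv.imp_right fun h => h.1) (Or.inl rfl) fun v hv hvM p hp => by
      by_contra! hlong
      have hess : A'.IsEssential v := hv.resolve_left fun h => hvM (Or.inl h)
      exact hvM (Or.inr ⟨hess, exists_cluster_eq hε' hε0 hroot.symm hess hp hlong⟩)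
  obtain ⟨e, her, hep, hec⟩ := exists_equiv hι hrange hι' hrange'
  have hshrink : Reaches (2 * ε) (Fintype.card S.V) S S' := by
    refine reaches_of_equiv e her hep fun a ha => ?_
    have ha' : e a ≠ S'.root := fun h => ha (e.injective (h.trans her.symm))
    obtain ⟨p, hp, hwp⟩ := hw a ha
    obtain ⟨p', hp', hwp'⟩ := hw' (e a) ha'
    have hess := isEssential_of_range hι hrange ha
    have hess' := isEssential_of_range hι' hrange' ha'
    have hc := hec a ha
    have h1 := height_le_of_cluster_eq hε hess hc
    have h2 := height_le_of_cluster_eq hε' hess' hc.symm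
    have h3 := height_next_le_of_cluster_eq hε hε0 hroot hess hp hp' hc
    have h4 := height_next_le_of_cluster_eq hε' hε0 hroot.symm hess' hp' hp hc.symm
    rw [hwp, hwp', abs_le]
    constructor <;> linarith
  exact ((hn.trans hshrink).trans hn'.symm).mono (by omega)

end Marking
end WeightedTree

/-! ### The interleaving of the components of two nearby functions -/

section Interleaving

variable {X : Type u} [TopologicalSpace X] {f g : X → ℝ} {ε : ℝ}

/-- The inclusion of `{f ≤ s}` into `{g ≤ s'}`, if `g ≤ f + ε` and `s + ε ≤ s'`. -/
def transferInclusion (hfg : ∀ x, g x ≤ f x + ε) {s s' : ℝ} (h : s + ε ≤ s')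
    (x : {x : X // f x ≤ s}) : {x : X // g x ≤ s'} :=
  ⟨x.1, (hfg x.1).trans ((add_le_add_left x.2 ε).trans h)⟩

theorem continuous_transferInclusion (hfg : ∀ x, g x ≤ f x + ε) {s s' : ℝ} (h : s + ε ≤ s') :
    Continuous (transferInclusion hfg h) :=
  continuous_subtype_val.subtype_mk _

/-- The map `π₀(f ≤ s) → π₀(g ≤ s')` induced by the inclusion, if `g ≤ f + ε` and `s + ε ≤ s'`. -/
def Comp.transfer (hfg : ∀ x, g x ≤ f x + ε) {s s' : ℝ} (h : s + ε ≤ s') : Comp f s → Comp g s' :=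
  ZerothHomotopy.lift (fun x => ZerothHomotopy.mk (transferInclusion hfg h x))
    (fun _ _ p => ZerothHomotopy.sound (p.map (continuous_transferInclusion hfg h)))

theorem Comp.map_transfer (hfg : ∀ x, g x ≤ f x + ε) {r s r' s' : ℝ} (hr : r + ε ≤ r')
    (hs : s + ε ≤ s') (h : r ≤ s) (h' : r' ≤ s') (u : Comp f r) :
    Comp.map g h' (Comp.transfer hfg hr u) = Comp.transfer hfg hs (Comp.map f h u) := by
  induction u using ZerothHomotopy.rec with
  | mk x => rfl

theorem Comp.transfer_transfer (hfg : ∀ x, g x ≤ f x + ε) (hgf : ∀ x, f x ≤ g x + ε) {r s t : ℝ}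
    (h : r + ε ≤ s) (h' : s + ε ≤ t) (h'' : r ≤ t) (u : Comp f r) :
    Comp.transfer hgf h' (Comp.transfer hfg h u) = Comp.map f h'' u := by
  induction u using ZerothHomotopy.rec with
  | mk x => rfl

/-- The component of `g` just above the level `t + ε` that contains a given component of `f` just
above the level `t`. -/
def Branch.transfer (hfg : ∀ x, g x ≤ f x + ε) {t : ℝ} (b : Branch f t) : Branch g (t + ε) :=
  ⟨fun s => Comp.transfer hfg (sub_add_cancel s.1 ε).le
      (b.1 ⟨s.1 - ε, Set.mem_Ioi.mpr (lt_sub_iff_add_lt.mpr s.2)⟩), fun r s h => by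
    have h1 := b.2 ⟨r.1 - ε, Set.mem_Ioi.mpr (lt_sub_iff_add_lt.mpr r.2)⟩
      ⟨s.1 - ε, Set.mem_Ioi.mpr (lt_sub_iff_add_lt.mpr s.2)⟩ (sub_le_sub_right h ε)
    exact (Comp.map_transfer hfg _ _ (sub_le_sub_right h ε) h _).trans (congrArg _ h1)⟩

/-- The map of points induced by `g ≤ f + ε`; it raises levels by `ε`. -/
def Point.transfer (hfg : ∀ x, g x ≤ f x + ε) (p : Point f) : Point g :=
  ⟨p.1 + ε, p.2.transfer hfg⟩

namespace Point

theorem transfer_mono (hfg : ∀ x, g x ≤ f x + ε) {p q : Point f} (h : p ≤ q) :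
    p.transfer hfg ≤ q.transfer hfg := by
  obtain ⟨h1, h2⟩ := h
  refine ⟨add_le_add_left h1 ε, ?_⟩
  change (p.2.transfer hfg).map _ = q.2.transfer hfg
  rw [← h2]
  rfl

theorem le_transfer_transfer (hε0 : 0 ≤ ε) (hfg : ∀ x, g x ≤ f x + ε)
    (hgf : ∀ x, f x ≤ g x + ε) (p : Point f) : p ≤ (p.transfer hfg).transfer hgf := by
  refine ⟨by change p.1 ≤ p.1 + ε + ε; linarith, Branch.ext_of_forall fun s => ?_⟩
  have hs : p.1 + ε + ε < s.1 := s.2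
  have h1 : p.1 < s.1 - ε - ε := by linarith
  have h2 := p.2.2 ⟨s.1 - ε - ε, h1⟩ ⟨s.1, by change p.1 < s.1; linarith⟩
    (by change s.1 - ε - ε ≤ s.1; linarith)
  refine h2.symm.trans (Comp.transfer_transfer hfg hgf _ _ _ _).symm

theorem total {p q r : Point f} (hq : p ≤ q) (hr : p ≤ r) : q ≤ r ∨ r ≤ q :=
  (le_total q.1 r.1).imp (le_of_le_of_le hq hr) (le_of_le_of_le hr hq)

theorem IsLeaf.eq_of_le {p q : Point f} (hq : q.IsLeaf) (h : p ≤ q) : p = q :=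
  h.eq_of_not_lt (hq p)

end Point

/-- Two components none of which contains the other, and which are both contained in `r`, merge in a
vertex contained in `r`. -/
theorem exists_vertex_between (hf : IsTame f) {p q r : Point f} (hpq : ¬ p ≤ q) (hqp : ¬ q ≤ p)
    (hpr : p ≤ r) (hqr : q ≤ r) : ∃ v : Vertex f, p < v.1 ∧ q < v.1 ∧ v.1 ≤ r := by
  classical
  obtain ⟨S, hS⟩ := hf.exists_criticalSet
  set m := max p.1 q.1 with hm
  have hpm : p.1 ≤ m := le_max_left _ _
  have hqm : q.1 ≤ m := le_max_right _ _
  have hmr : m ≤ r.1 := max_le hpr.1 hqr.1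
  have hne : p.2.map hpm ≠ q.2.map hqm := by
    intro he
    have h1 : p ≤ (⟨m, q.2.map hqm⟩ : Point f) := ⟨hpm, he⟩
    have h2 : q ≤ (⟨m, q.2.map hqm⟩ : Point f) := ⟨hqm, rfl⟩
    rcases le_total p.1 q.1 with h | h
    · exact hpq (h1.trans (Point.le_of_le_of_le h2 le_rfl (max_eq_right h).le))
    · refine hqp (h2.trans (Point.le_of_le_of_le h1 le_rfl (max_eq_left h).le))
  -- If the two components have merged at level `t`, they have merged at a critical value `c ≤ t`.
  have step : ∀ t (ht : m ≤ t), p.2.map (hpm.trans ht) = q.2.map (hqm.trans ht) →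
      ∃ c ∈ S, c ≤ t ∧ ∃ hc : m < c, p.2.map (hpm.trans hc.le) = q.2.map (hqm.trans hc.le) := by
    intro t ht he
    obtain ⟨c, hc, hct, hfree⟩ := exists_max_mem_le hS ⟨t, p.2.map (hpm.trans ht)⟩
    have hct' : c ≤ t := hct
    rcases lt_or_ge m c with hmc | hcm
    · exact ⟨c, hc, hct, hmc, (Branch.map_bijective hS hct' hfree).1 he⟩
    · exact absurd ((Branch.map_bijective hS ht fun a ha hab =>
        hfree a ha ⟨hcm.trans_lt hab.1, hab.2⟩).1 he) hne
  obtain ⟨c0, hc0, hc0r, hc0'⟩ := step r.1 hmr (hpr.2.trans hqr.2.symm)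
  obtain ⟨c, hc, hmin⟩ := (S.filter fun c => ∃ hc : m < c,
    p.2.map (hpm.trans hc.le) = q.2.map (hqm.trans hc.le)).exists_min_image id
    ⟨c0, Finset.mem_filter.mpr ⟨hc0, hc0'⟩⟩
  obtain ⟨hcS, hmc, he⟩ := Finset.mem_filter.mp hc
  have hcr : c ≤ r.1 := (hmin c0 (Finset.mem_filter.mpr ⟨hc0, hc0'⟩)).trans hc0r
  have hmerge : Point.IsMerge (⟨c, p.2.map (hpm.trans hmc.le)⟩ : Point f) := by
    refine ⟨m, hmc, p.2.map hpm, q.2.map hqm, rfl, he.symm, fun t ht htc het => ?_⟩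
    obtain ⟨c', hc', hct', hmc', he'⟩ := step t ht het
    exact absurd (hmin c' (Finset.mem_filter.mpr ⟨hc', hmc', he'⟩))
      (not_le.mpr (hct'.trans_lt htc))
  have hpc : p ≤ (⟨c, p.2.map (hpm.trans hmc.le)⟩ : Point f) := ⟨hpm.trans hmc.le, rfl⟩
  have hqc : q ≤ (⟨c, p.2.map (hpm.trans hmc.le)⟩ : Point f) := ⟨hqm.trans hmc.le, he.symm⟩
  refine ⟨⟨_, Or.inr hmerge⟩, hpc.lt_of_ne ?_, hqc.lt_of_ne ?_, Point.le_of_le_of_le hpc hpr hcr⟩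
  · exact fun h => hqp (hqc.trans h.ge)
  · exact fun h => hpq (hpc.trans h.ge)

theorem exists_vertex_le (hf : IsTame f) {x y r : Point f} (hx : x.IsLeaf) (hy : y.IsLeaf)
    (hxr : x ≤ r) (hyr : y ≤ r) : ∃ v : Vertex f, x ≤ v.1 ∧ y ≤ v.1 ∧ v.1 ≤ r := by
  by_cases hxy : x ≤ y
  · exact ⟨⟨y, Or.inl hy⟩, hxy, le_rfl, hyr⟩
  by_cases hyx : y ≤ x
  · exact ⟨⟨x, Or.inl hx⟩, le_rfl, hyx, hxr⟩
  obtain ⟨v, h1, h2, h3⟩ := exists_vertex_between hf hxy hyx hxr hyr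
  exact ⟨v, h1.le, h2.le, h3⟩

/-- If a leaf `k` lies in `w`, and the component `q` at height `c` above `k` contains a leaf outside
`w`, then there is a vertex above `w` at distance at most `c`. -/
theorem exists_vertex_gt (hf : IsTame f) {w : Vertex f} {k q x : Point f} {c : ℝ} (hkw : k ≤ w.1)
    (hkq : k ≤ q) (hq : q.1 = k.1 + c) (hx : x.IsLeaf) (hxq : x ≤ q) (hxw : ¬ x ≤ w.1) :
    ∃ v : Vertex f, w < v ∧ v.1.1 ≤ w.1.1 + c := by
  have hwq : w.1 ≤ q := (Point.total hkw hkq).resolve_right fun h => hxw (hxq.trans h)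
  obtain ⟨v, hwv, -, hvq⟩ := exists_vertex_between hf (fun h => hxw (hx.eq_of_le h).ge) hxw hwq hxq
  have h1 : k.1 ≤ w.1.1 := hkw.1
  have h2 : v.1.1 ≤ q.1 := hvq.1
  exact ⟨v, hwv, by linarith⟩

/-- Corresponding leaves `left i` of `f` and `right i` of `g`: the images of the `left i` under
`Point.transfer` are pairwise incomparable, below the image of every leaf there is one of them (so
they are the minimal images of leaves, each taken once), and `right i` lies below the image of
`left i`. -/
structure LeafMatching (hfg : ∀ x, g x ≤ f x + ε) (I : Type u) where
  left : I → Point f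
  right : I → Point g
  isLeaf_left : ∀ i, (left i).IsLeaf
  isLeaf_right : ∀ i, (right i).IsLeaf
  right_le : ∀ i, right i ≤ (left i).transfer hfg
  eq_of_le : ∀ i j, (left i).transfer hfg ≤ (left j).transfer hfg → i = j
  exists_le : ∀ k : Point f, k.IsLeaf → ∃ i, (left i).transfer hfg ≤ k.transfer hfg

theorem LeafMatching.exists (hf : IsTame f) (hg : IsTame g) (hfg : ∀ x, g x ≤ f x + ε) :
    ∃ I : Type u, Finite I ∧ Nonempty (LeafMatching hfg I) := by
  obtain ⟨S, hS⟩ := hg.exists_criticalSet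
  have := Vertex.finite hf
  set B : Set (Point g) := Point.transfer hfg '' {k | k.IsLeaf} with hB
  have hfin : B.Finite := by
    refine Set.Finite.image _ (Set.Finite.subset (Set.finite_range (Subtype.val : Vertex f → _)) ?_)
    exact fun k hk => ⟨⟨k, Or.inl hk⟩, rfl⟩
  choose l hl hlq using fun q : {q // Minimal (· ∈ B) q} => q.2.1
  choose l' hlq' hl' using fun q : {q // Minimal (· ∈ B) q} => exists_leaf_le hS q.1
  refine ⟨{q // Minimal (· ∈ B) q}, (hfin.subset fun q hq => hq.1).to_subtype, ⟨?_⟩⟩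
  refine ⟨l, l', hl, hl', fun i => (hlq i).symm ▸ hlq' i, fun i j h => ?_, fun k hk => ?_⟩
  · rw [hlq, hlq] at h
    exact Subtype.ext (h.antisymm (j.2.2 i.2.1 h))
  · obtain ⟨q, hq, hmin⟩ := hfin.exists_le_minimal (⟨k, hk, rfl⟩ : k.transfer hfg ∈ B)
    exact ⟨⟨q, hmin⟩, (hlq _).trans_le hq⟩

namespace LeafMatching

variable {hfg : ∀ x, g x ≤ f x + ε} {I : Type u} (m : LeafMatching hfg I)

theorem exists_vertex_gt_left (hf : IsTame f) (hε0 : 0 ≤ ε) (hgf : ∀ x, f x ≤ g x + ε)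
    {w : Vertex f} (hw : ∀ i, ¬ m.left i ≤ w.1) :
    ∃ v : Vertex f, w < v ∧ v.1.1 ≤ w.1.1 + 2 * ε := by
  obtain ⟨S, hS⟩ := hf.exists_criticalSet
  obtain ⟨k, hkw, hk⟩ := exists_leaf_le hS w.1
  obtain ⟨i, hi⟩ := m.exists_le k hk
  exact exists_vertex_gt hf hkw (Point.le_transfer_transfer hε0 hfg hgf k)
    (by change k.1 + ε + ε = _; ring) (m.isLeaf_left i)
    ((Point.le_transfer_transfer hε0 hfg hgf _).trans (Point.transfer_mono hgf hi)) (hw i)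

theorem exists_vertex_gt_right (hf : IsTame f) (hg : IsTame g) (hε0 : 0 ≤ ε)
    (hgf : ∀ x, f x ≤ g x + ε) {w : Vertex g} (hw : ∀ i, ¬ m.right i ≤ w.1) :
    ∃ v : Vertex g, w < v ∧ v.1.1 ≤ w.1.1 + 2 * ε := by
  obtain ⟨S, hS⟩ := hf.exists_criticalSet
  obtain ⟨S', hS'⟩ := hg.exists_criticalSet
  obtain ⟨k, hkw, hk⟩ := exists_leaf_le hS' w.1
  obtain ⟨k', hk', hkl'⟩ := exists_leaf_le hS (k.transfer hgf)
  obtain ⟨i, hi⟩ := m.exists_le k' hkl'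
  exact exists_vertex_gt hg hkw (Point.le_transfer_transfer hε0 hgf hfg k)
    (by change k.1 + ε + ε = _; ring) (m.isLeaf_right i)
    ((m.right_le i).trans (hi.trans (Point.transfer_mono hfg hk'))) (hw i)

theorem exists_vertex_right (hg : IsTame g) {i j : I} {z : Vertex f} (hi : m.left i ≤ z.1)
    (hj : m.left j ≤ z.1) :
    ∃ z' : Vertex g, m.right i ≤ z'.1 ∧ m.right j ≤ z'.1 ∧ z'.1.1 ≤ z.1.1 + ε := by
  obtain ⟨z', h1, h2, h3⟩ := exists_vertex_le hg (m.isLeaf_right i) (m.isLeaf_right j)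
    ((m.right_le i).trans (Point.transfer_mono hfg hi))
    ((m.right_le j).trans (Point.transfer_mono hfg hj))
  exact ⟨z', h1, h2, h3.1⟩

theorem left_le_right_add (hf : IsTame f) (hε0 : 0 ≤ ε) (hgf : ∀ x, f x ≤ g x + ε) (i : I) :
    (m.left i).1 ≤ (m.right i).1 + ε := by
  obtain ⟨S, hS⟩ := hf.exists_criticalSet
  obtain ⟨k, hk, hkl⟩ := exists_leaf_le hS ((m.right i).transfer hgf)
  have hk1 : k.1 ≤ (m.right i).1 + ε := hk.1
  by_contra! hlt
  -- Otherwise the image of the leaf `k` lies below that of `left i`, which is minimal.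
  have hki : k.transfer hfg ≤ (m.left i).transfer hfg :=
    (Point.transfer_mono hfg hk).trans (Point.le_of_le_of_le
      (Point.le_transfer_transfer hε0 hgf hfg _) (m.right_le i) (add_le_add_left hlt.le ε))
  obtain ⟨j, hj⟩ := m.exists_le k hkl
  obtain rfl := m.eq_of_le j i (hj.trans hki)
  have h1 : (m.left j).1 + ε ≤ k.1 + ε := hj.1
  linarith

/-- A vertex above `right i` and `right j` is also above the image of `left i` if `i ≠ j`, since
otherwise the images of `left i` and `left j` would be comparable. -/
theorem exists_vertex_left (hf : IsTame f) (hε0 : 0 ≤ ε) (hgf : ∀ x, f x ≤ g x + ε) {i j : I}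
    {z : Vertex g} (hi : m.right i ≤ z.1) (hj : m.right j ≤ z.1) :
    ∃ z' : Vertex f, m.left i ≤ z'.1 ∧ m.left j ≤ z'.1 ∧ z'.1.1 ≤ z.1.1 + ε := by
  have key : ∀ i j, i ≠ j → m.right i ≤ z.1 → m.right j ≤ z.1 →
      m.left i ≤ z.1.transfer hgf := by
    intro i j hij hi hj
    refine (Point.le_transfer_transfer hε0 hfg hgf _).trans (Point.transfer_mono hgf ?_)
    refine (Point.total (m.right_le i) hi).resolve_right fun h => ?_
    rcases Point.total (m.right_le j) (hj.trans h) with h' | h'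
    · exact hij (m.eq_of_le j i h').symm
    · exact hij (m.eq_of_le i j h')
  by_cases hij : i = j
  · subst hij
    have h1 : (m.right i).1 ≤ z.1.1 := hi.1
    have h2 := m.left_le_right_add hf hε0 hgf i
    exact ⟨⟨m.left i, Or.inl (m.isLeaf_left i)⟩, le_rfl, le_rfl,
      by change (m.left i).1 ≤ _; linarith⟩
  · obtain ⟨z', h1, h2, h3⟩ := exists_vertex_le hf (m.isLeaf_left i) (m.isLeaf_left j)
      (key i j hij hi hj) (key j i (Ne.symm hij) hj hi)
    exact ⟨z', h1, h2, h3.1⟩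

end LeafMatching

end Interleaving
end MergeTrees

namespace MergeTrees

/-! ### The merge tree with its marked leaves -/

theorem isFather_of_father_eq_some {X : Type u} [TopologicalSpace X] {f : X → ℝ} {v w : Vertex f}
    (h : father f (some v) = some w) :
    Vertex.IsFather v w := by
  by_cases hex : ∃ w, Vertex.IsFather v w
  · have h1 : father f (some v) = some hex.choose := by simp [father, hex]
    rw [h1] at h
    exact Option.some_injective _ h ▸ hex.choose_spec
  · have h1 : father f (some v) = none := by simp [father, hex]
    rw [h1] at h
    exact absurd h.symm (Option.some_ne_none w)

section MergeTree

variable {X : Type u} [TopologicalSpace X] [PathConnectedSpace X] {f : X → ℝ} (hf : IsTame f)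
  (hb : BddAbove (Set.range f))

/-- The ancestor order of the merge tree is the inclusion of components. -/
theorem mergeTree_le_iff (v w : Vertex f) :
    (mergeTree f hf hb).Le (some v) (some w) ↔ v ≤ w := by
  constructor
  · rintro ⟨n, hn⟩
    change (father f)^[n] (some v) = some w at hn
    induction n generalizing v with
    | zero => exact (Option.some_injective _ hn).le
    | succ n ih =>
      rw [Function.iterate_succ_apply] at hn
      cases hp : father f (some v) with
      | none =>
        rw [hp, Function.iterate_fixed (f := father f) rfl] at hn
        exact absurd hn.symm (Option.some_ne_none w)
      | some u =>
        rw [hp] at hn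
        exact (isFather_of_father_eq_some hp).1.le.trans (ih u hn)
  · intro h
    have := Vertex.finite hf
    -- The highest vertex reached from `v` without leaving the lower set of `w` is `w`.
    obtain ⟨u, ⟨hvu, huw⟩, hmax⟩ := Set.exists_max_image
      {u : Vertex f | (mergeTree f hf hb).Le (some v) (some u) ∧ u ≤ w} (fun u => u.1.1)
      (Set.toFinite _) ⟨v, RootedTree.Le.refl _, h⟩
    rcases huw.lt_or_eq with hlt | rfl
    · cases hp : father f (some u) with
      | none => exact absurd hlt ((father_eq_none_iff hf u).mp hp w)
      | some u' =>
        have hu' := isFather_of_father_eq_some hp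
        have h1 : (mergeTree f hf hb).Le (some u) (some u') := ⟨1, hp⟩
        exact absurd (Point.fst_lt (p := u.1) (q := u'.1) hu'.1)
          (not_lt.mpr (hmax u' ⟨hvu.trans h1, hu'.2 w hlt⟩))
    · exact hvu

variable (K : ℝ) (hK : ∀ v, v ≠ (mergeTree f hf hb).root →
  (mergeTree f hf hb).height v < (K : WithTop ℝ))

/-- The truncated merge tree with a family of leaves as marked vertices. -/
noncomputable def leafMarking {I : Type u} (l : I → Point f) (hl : ∀ i, (l i).IsLeaf) :
    ((mergeTree f hf hb).truncate K hK).Marking I where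
  height := (mergeTree f hf hb).truncHeight K
  isHeight _ _ := rfl
  mark i := some ⟨l i, Or.inl (hl i)⟩

variable {hf hb K hK} {I : Type u} {l : I → Point f} {hl : ∀ i, (l i).IsLeaf}

theorem mem_cluster_leafMarking {i : I} {v : Vertex f} :
    i ∈ (leafMarking hf hb K hK l hl).cluster (some v) ↔ l i ≤ v.1 :=
  mergeTree_le_iff hf hb _ v

theorem leafMarking_height_some (v : Vertex f) :
    (leafMarking hf hb K hK l hl).height (some v) = v.1.1 := rfl

theorem exists_eq_some {v : ((mergeTree f hf hb).truncate K hK).V}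
    (hv : v ≠ ((mergeTree f hf hb).truncate K hK).root) : ∃ w : Vertex f, v = some w :=
  Option.ne_none_iff_exists'.mp hv

/-- A vertex without marked leaves has a short edge if some vertex lies closely above it. -/
theorem leafMarking_weight_le {c : ℝ}
    (h : ∀ w : Vertex f, (∀ i, ¬ l i ≤ w.1) → ∃ u : Vertex f, w < u ∧ u.1.1 ≤ w.1.1 + c)
    (v : ((mergeTree f hf hb).truncate K hK).V)
    (hv : v ≠ ((mergeTree f hf hb).truncate K hK).root)
    (hc : (leafMarking hf hb K hK l hl).cluster v = ∅) :
    ((mergeTree f hf hb).truncate K hK).weight v ≤ c := by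
  rw [(leafMarking hf hb K hK l hl).isHeight v hv]
  obtain ⟨w, rfl⟩ := exists_eq_some hv
  obtain ⟨u, hwu, hu⟩ := h w fun i hi =>
    (Set.eq_empty_iff_forall_notMem.mp hc) i (mem_cluster_leafMarking.mpr hi)
  have h1 := (leafMarking hf hb K hK l hl).isHeight.mono
    (RootedTree.parent_le_of_le_of_ne ((mergeTree_le_iff hf hb w u).mpr hwu.le)
      fun h => hwu.ne (Option.some_injective _ h))
  rw [leafMarking_height_some] at h1 ⊢
  have h2 := h1.trans hu
  exact sub_le_iff_le_add'.mpr h2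

end MergeTree

end MergeTrees

theorem mainTheorem1 {X : Type u} [TopologicalSpace X] [PathConnectedSpace X]
    (f g : X → ℝ) (hf : MergeTrees.IsTame f) (hg : MergeTrees.IsTame g)
    (hfb : BddAbove (Set.range f)) (hgb : BddAbove (Set.range g))
    (ε : ℝ) (hε : ∀ x, |f x - g x| ≤ ε)
    (K : ℝ)
    (hKf : ∀ v, v ≠ (MergeTrees.mergeTree f hf hfb).root →
      (MergeTrees.mergeTree f hf hfb).height v < (K : WithTop ℝ))
    (hKg : ∀ v, v ≠ (MergeTrees.mergeTree g hg hgb).root →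
      (MergeTrees.mergeTree g hg hgb).height v < (K : WithTop ℝ)) :
    (∃ cs : List ℝ,
      MergeTrees.WeightedTree.EditPath ((MergeTrees.mergeTree f hf hfb).truncate K hKf)
        ((MergeTrees.mergeTree g hg hgb).truncate K hKg) cs ∧
      cs.length ≤ Fintype.card (MergeTrees.mergeTree f hf hfb).V +
        Fintype.card (MergeTrees.mergeTree g hg hgb).V ∧
      ∀ c ∈ cs, c ≤ 2 * ε) ∧
    MergeTrees.WeightedTree.editDist ((MergeTrees.mergeTree f hf hfb).truncate K hKf)
        ((MergeTrees.mergeTree g hg hgb).truncate K hKg) ≤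
      2 * ε * (Fintype.card (MergeTrees.mergeTree f hf hfb).V +
        Fintype.card (MergeTrees.mergeTree g hg hgb).V : ℝ) := by
  open MergeTrees WeightedTree Marking in
  obtain ⟨x⟩ : Nonempty X := inferInstance
  have hε0 : 0 ≤ ε := (abs_nonneg _).trans (hε x)
  have hfg : ∀ x, g x ≤ f x + ε := fun x => by linarith [(abs_le.mp (hε x)).1]
  have hgf : ∀ x, f x ≤ g x + ε := fun x => by linarith [(abs_le.mp (hε x)).2]
  obtain ⟨I, hI, ⟨m⟩⟩ := LeafMatching.exists hf hg hfg
  let A := leafMarking hf hfb K hKf m.left m.isLeaf_left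
  let A' := leafMarking hg hgb K hKg m.right m.isLeaf_right
  have h1 : ∀ i j, A'.join i j ≤ A.join i j + ε := fun i j =>
    join_le_join_add (A := A) (A' := A') hε0 rfl fun z hz hi hj => by
      obtain ⟨z, rfl⟩ := exists_eq_some hz
      obtain ⟨z', hi', hj', hz'⟩ := m.exists_vertex_right hg (mem_cluster_leafMarking.mp hi)
        (mem_cluster_leafMarking.mp hj)
      exact ⟨some z', mem_cluster_leafMarking.mpr hi', mem_cluster_leafMarking.mpr hj', hz'⟩
  have h2 : ∀ i j, A.join i j ≤ A'.join i j + ε := fun i j =>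
    join_le_join_add (A := A') (A' := A) hε0 rfl fun z hz hi hj => by
      obtain ⟨z, rfl⟩ := exists_eq_some hz
      obtain ⟨z', hi', hj', hz'⟩ := m.exists_vertex_left hf hε0 hgf
        (mem_cluster_leafMarking.mp hi) (mem_cluster_leafMarking.mp hj)
      exact ⟨some z', mem_cluster_leafMarking.mpr hi', mem_cluster_leafMarking.mpr hj', hz'⟩
  have hreach := Marking.reaches (A := A) (A' := A')
    (fun i j => abs_le.mpr ⟨by linarith [h1 i j], by linarith [h2 i j]⟩) hε0 rfl
    (leafMarking_weight_le fun w => m.exists_vertex_gt_left hf hε0 hgf)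
    (leafMarking_weight_le fun w => m.exists_vertex_gt_right hf hg hε0 hgf)
  obtain ⟨cs, hcs, hlen, hc⟩ := hreach
  refine ⟨⟨cs, hcs, hlen, hc⟩, (editDist_le hcs).trans ?_⟩
  have hsum := List.sum_le_card_nsmul cs (2 * ε) hc
  rw [nsmul_eq_mul, mul_comm] at hsum
  refine hsum.trans (mul_le_mul_of_nonneg_left ?_ (by linarith))
  exact_mod_cast hlen
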